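/- Let $\lambda>0$ and let $G$ be a probability distribution on $[0,\infty)$. Customers arrive at times $T_n=I_1+\dots+I_n$ ($T_0=0$), where the $I_n$ are exponential with mean $1/\lambda$; the $n$-th customer has service requirement $S_n$ with law $G$, and all $I_n$ and $S_n$, $n\ge 1$, are independent. For $x\ge 0$ let $V_t^x$ be the workload process of the queue with bounded waiting time: $V_0^x=x$, $V_t^x=\max[V_{T_{n-1}}^x-(t-T_{n-1}),0]$ for $T_{n-1}\le t<T_n$, and $V_{T_n}^x=V_{T_n-}^x+S_n\mathbf 1_{\{V_{T_n-}^x<1\}}$, where $V_{T_n-}^x$ is the workload immediately before time $T_n$. A probability measure $\pi$ on $[0,\infty)$ is an invariant distribution if $\int \mathbb P(V_t^x\in A)\,\pi(dx)=\pi(A)$ for all $t\ge 0$ and all Borel sets $A$. Let $\bar G(x)=G((x,\infty))$, $\bar G^{*1}=\bar G$ and $\bar G^{*(i+1)}(x)=\int_0^x\bar G(x-y)\,\bar G^{*i}(y)\,dy$ for $x>0$. If $\mathbb E(S_1)<\infty$, then the process has an invariant distribution, and the restriction of any invariant distribution to $(0,\infty)$ has the Lebesgue density $$\tilde\pi(x)=\begin{cases}\dfrac{\sum_{i=1}^\infty\lambda^i\bar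 G^{*i}(x)}{1+\lambda\mathbb E(S_1)\bigl(1+\sum_{i=1}^\infty\lambda^i\int_0^1\bar G^{*i}(y)\,dy\bigr)}, & x\in(0,1],\\[3ex] \dfrac{\lambda\bar G(x)+\lambda\sum_{i=1}^\infty\lambda^i\int_0^1\bar G(x-y)\,\bar G^{*i}(y)\,dy}{1+\lambda\mathbb E(S_1)\bigl(1+\sum_{i=1}^\infty\lambda^i\int_0^1\bar G^{*i}(y)\,dy\bigr)}, & x\in(1,\infty),\end{cases}$$ where all the series converge. (The remaining mass of the invariant distribution is an atom at $0$; in particular the invariant distribution is unique.) -/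

import Mathlib

open MeasureTheory ProbabilityTheory Set

noncomputable section

namespace BoundedWait

/-- The primitives of an `M/G/1` queue on `(Ω, P)`: `I n` is the time between the arrivals of
customers `n` and `n + 1` (customer `0` being a fictitious arrival at time `0`), exponential with
mean `1 / lam`, and `S n` is the service requirement of customer `n + 1`, with law `G`;
all of these random variables are independent. -/
structure IsMG1Input {Ω : Type*} [MeasurableSpace Ω] (P : Measure Ω) (lam : ℝ) (G : Measure ℝ)
    (I S : ℕ → Ω → ℝ) : Prop where
  measurable_I : ∀ n, Measurable (I n)
  measurable_S : ∀ n, Measurable (S n)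
  law_I : ∀ n, P.map (I n) = expMeasure lam
  law_S : ∀ n, P.map (S n) = G
  indep : iIndepFun (Sum.elim I S : ℕ ⊕ ℕ → Ω → ℝ) P

section Construction

variable {Ω : Type*} (I S : ℕ → Ω → ℝ)

/-- The arrival time of the `n`-th customer, with value `0` for `n = 0`. -/
def arrivalTime (n : ℕ) (ω : Ω) : ℝ := ∑ k ∈ Finset.range n, I k ω

/-- The workload of the queue with initial workload `x` immediately after the `n`-th arrival
(for `n = 0`: at time `0`). Between arrivals the workload decreases at unit rate until it
reaches `0`; an arriving customer is admitted exactly when the workload just before the arrival,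
which is the waiting time in line, is less than `1`. -/
def workloadAtArrival (x : ℝ) : ℕ → Ω → ℝ
  | 0, _ => x
  | n + 1, ω =>
    max (workloadAtArrival x n ω - I n ω) 0 +
      (if max (workloadAtArrival x n ω - I n ω) 0 < 1 then S n ω else 0)

/-- The number of arrivals in the time interval `(0, t]`. -/
def arrivalCount (t : ℝ) (ω : Ω) : ℕ := sSup {n : ℕ | arrivalTime I n ω ≤ t}

/-- The workload at time `t ≥ 0` of the queue with bounded waiting time and initial
workload `x`. -/
def workload (x t : ℝ) (ω : Ω) : ℝ :=
  max (workloadAtArrival I S x (arrivalCount I t ω) ω -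
    (t - arrivalTime I (arrivalCount I t ω) ω)) 0

end Construction

/-- `π` is an invariant distribution of the workload process: a probability measure on `[0, ∞)`
with `∫ P (V_t^x ∈ A) π(dx) = π(A)` for all times `t ≥ 0` and all Borel sets `A`. -/
structure IsInvariant {Ω : Type*} [MeasurableSpace Ω] (P : Measure Ω) (I S : ℕ → Ω → ℝ)
    (π : Measure ℝ) : Prop where
  isProbabilityMeasure : IsProbabilityMeasure π
  nonneg : π (Iio 0) = 0
  invariant : ∀ t : ℝ, 0 ≤ t → ∀ A : Set ℝ, MeasurableSet A →
    ∫⁻ x, P {ω | workload I S x t ω ∈ A} ∂π = π A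

/-- The tail `x ↦ G (x, ∞)` of the service time distribution. -/
def tail (G : Measure ℝ) (x : ℝ) : ℝ := G.real (Ioi x)

/-- The convolution powers of the tail of `G` on `(0, ∞)`: `tailConv G i` is the convolution of
`i + 1` copies of `tail G`. -/
def tailConv (G : Measure ℝ) : ℕ → ℝ → ℝ
  | 0, x => tail G x
  | i + 1, x => ∫ y in (0 : ℝ)..x, tail G (x - y) * tailConv G i y

/-- The normalizing constant of the invariant density. -/
def normalizer (lam : ℝ) (G : Measure ℝ) : ℝ :=
  1 + lam * (∫ s, s ∂G) *
    (1 + ∑' i : ℕ, lam ^ (i + 1) * ∫ y in (0 : ℝ)..1, tailConv G i y)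

/-- The invariant density on `(0, ∞)`. -/
def invariantDensity (lam : ℝ) (G : Measure ℝ) (x : ℝ) : ℝ :=
  if x ≤ 1 then
    (∑' i : ℕ, lam ^ (i + 1) * tailConv G i x) / normalizer lam G
  else
    (lam * tail G x +
      lam * ∑' i : ℕ, lam ^ (i + 1) * ∫ y in (0 : ℝ)..1, tail G (x - y) * tailConv G i y) /
      normalizer lam G

end BoundedWait

end

/-!
Split the path of the workload at its last arrival before time `t`. By memorylessness of the
exponential law, the value of `∫ f(V_t^x) π(dx)` is determined by the law of the workload at earlier
times, and `π` is invariant if and only if it is preserved by one step: let a customer arrive, then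
let the workload drain for an exponential time. Comparing tails on both sides, weighted by the
survival function of the exponential law, turns this fixed-point equation into a level-crossing
identity: on `(0, ∞)` the measure `π` has at `x` the density `lam` times the probability that an
arrival lifts the workload over `x`. Only workloads below `1` jump, so on `(0, 1]` the identity is a
Volterra equation whose solution is the mass of the atom at `0` times the renewal series
`∑ lam ^ (i + 1) * tailConv G i`; the density on `(1, ∞)` is then explicit, and total mass `1`
fixes the atom.
-/

namespace BoundedWait

open scoped ENNReal

section Exponential

/-- The probability that a Poisson process of rate `lam` has no point in a period of length `r`,
extended by `0` to negative `r`. -/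
noncomputable def survival (lam r : ℝ) : ℝ≥0∞ :=
  if 0 ≤ r then ENNReal.ofReal (Real.exp (-(lam * r))) else 0

variable {lam : ℝ}

lemma survival_of_nonneg {r : ℝ} (hr : 0 ≤ r) :
    survival lam r = ENNReal.ofReal (Real.exp (-(lam * r))) := if_pos hr

lemma survival_of_neg {r : ℝ} (hr : r < 0) : survival lam r = 0 := if_neg hr.not_ge

lemma survival_add {r s : ℝ} (hr : 0 ≤ r) (hs : 0 ≤ s) :
    survival lam (r + s) = survival lam r * survival lam s := by
  rw [survival_of_nonneg hr, survival_of_nonneg hs, survival_of_nonneg (add_nonneg hr hs),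
    ← ENNReal.ofReal_mul (Real.exp_pos _).le, ← Real.exp_add]
  ring_nf

@[fun_prop]
lemma measurable_survival : Measurable (survival lam) :=
  Measurable.ite measurableSet_Ici (by fun_prop) measurable_const

lemma tendsto_survival_atTop (hlam : 0 < lam) :
    Filter.Tendsto (survival lam) Filter.atTop (nhds 0) := by
  have h : Filter.Tendsto (fun t => ENNReal.ofReal (Real.exp (-(lam * t)))) Filter.atTop
      (nhds (ENNReal.ofReal 0)) :=
    ENNReal.tendsto_ofReal (Real.tendsto_exp_neg_atTop_nhds_zero.comp
      (Filter.tendsto_id.const_mul_atTop hlam))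
  rw [ENNReal.ofReal_zero] at h
  refine h.congr' ?_
  filter_upwards [Filter.eventually_ge_atTop 0] with t ht
  exact (survival_of_nonneg ht).symm

lemma exponentialPDF_eq_mul_survival (u : ℝ) :
    exponentialPDF lam u = ENNReal.ofReal lam * survival lam u := by
  rcases le_or_gt 0 u with hu | hu
  · rw [exponentialPDF_of_nonneg hu, survival_of_nonneg hu,
      ENNReal.ofReal_mul' (Real.exp_pos _).le]
  · rw [exponentialPDF_of_neg hu, survival_of_neg hu, mul_zero]

lemma lintegral_expMeasure {f : ℝ → ℝ≥0∞} (hf : Measurable f) :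
    ∫⁻ u, f u ∂expMeasure lam = ENNReal.ofReal lam * ∫⁻ u, survival lam u * f u := by
  have h : expMeasure lam = volume.withDensity fun u => ENNReal.ofReal lam * survival lam u :=
    congrArg volume.withDensity (funext exponentialPDF_eq_mul_survival)
  rw [h, lintegral_withDensity_eq_lintegral_mul _ (by fun_prop) hf,
    ← lintegral_const_mul _ (by fun_prop)]
  exact lintegral_congr fun u => mul_assoc _ _ _

lemma setLIntegral_expMeasure {f : ℝ → ℝ≥0∞} (hf : Measurable f) {A : Set ℝ}
    (hA : MeasurableSet A) :
    ∫⁻ u in A, f u ∂expMeasure lam = ENNReal.ofReal lam * ∫⁻ u in A, survival lam u * f u := by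
  rw [← lintegral_indicator hA, lintegral_expMeasure (hf.indicator hA), ← lintegral_indicator hA]
  simp only [indicator_mul_right]

lemma expMeasure_apply {A : Set ℝ} (hA : MeasurableSet A) :
    expMeasure lam A = ENNReal.ofReal lam * ∫⁻ u in A, survival lam u := by
  simpa using setLIntegral_expMeasure (lam := lam) measurable_one hA

lemma ae_nonneg_expMeasure : ∀ᵐ u ∂expMeasure lam, 0 ≤ u := by
  have h : ∫⁻ u in Iio (0 : ℝ), survival lam u = 0 :=
    (setLIntegral_congr_fun measurableSet_Iio fun u hu => survival_of_neg hu).trans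
      lintegral_zero
  rw [ae_iff]
  simp only [not_le]
  exact (expMeasure_apply measurableSet_Iio).trans (by rw [h, mul_zero])

/-- Both the period of length `r - u` after `u` and the exponential density at `u` are
exponential factors, so that their roles may be exchanged by reflection. -/
lemma lintegral_survival_sub_expMeasure (r : ℝ) {g : ℝ → ℝ≥0∞} (hg : Measurable g) :
    ∫⁻ u, survival lam (r - u) * g u ∂expMeasure lam =
      ∫⁻ u, survival lam (r - u) * g (r - u) ∂expMeasure lam := by
  rw [lintegral_expMeasure (by fun_prop), lintegral_expMeasure (by fun_prop),
    ← lintegral_sub_left_eq_self _ r]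
  simp only [sub_sub_cancel, mul_left_comm]

lemma setLIntegral_Ioi_expMeasure {t : ℝ} (ht : 0 ≤ t) {g : ℝ → ℝ≥0∞} (hg : Measurable g) :
    ∫⁻ v in Ioi t, g v ∂expMeasure lam =
      survival lam t * ∫⁻ v, g (v + t) ∂expMeasure lam := by
  have h_shift : ∀ v ≠ 0, (Ioi t).indicator (fun u => survival lam u * g u) (v + t) =
      survival lam t * (survival lam v * g (v + t)) := by
    intro v hv
    rcases hv.lt_or_gt with hv | hv
    · rw [indicator_of_notMem (by simpa using hv.le), survival_of_neg hv, zero_mul, mul_zero]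
    · rw [indicator_of_mem (by simpa using hv), survival_add hv.le ht]
      ring
  rw [setLIntegral_expMeasure hg measurableSet_Ioi, lintegral_expMeasure (by fun_prop),
    ← lintegral_indicator measurableSet_Ioi, ← lintegral_add_right_eq_self _ t,
    lintegral_congr_ae ((Measure.ae_ne volume 0).mono h_shift),
    lintegral_const_mul _ (by fun_prop), mul_left_comm]

lemma expMeasure_Ioi (hlam : 0 < lam) {t : ℝ} (ht : 0 ≤ t) :
    expMeasure lam (Ioi t) = survival lam t := by
  have := isProbabilityMeasure_expMeasure hlam
  simpa using setLIntegral_Ioi_expMeasure (lam := lam) ht measurable_one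

end Exponential

instance (lam : ℝ) : SFinite (expMeasure lam) :=
  inferInstanceAs (SFinite (volume.withDensity (exponentialPDF lam)))

lemma map_prodMk_snd_of_indepFun {α Ω β γ : Type*} [MeasurableSpace α] [MeasurableSpace Ω]
    [MeasurableSpace β] [MeasurableSpace γ] {μ : Measure α} [IsFiniteMeasure μ] {P : Measure Ω}
    [IsFiniteMeasure P] {X : α × Ω → β} {Y : Ω → γ} (hX : Measurable X) (hY : Measurable Y)
    (hXY : ∀ x, IndepFun (fun ω => X (x, ω)) Y P) :
    (μ.prod P).map (fun p => (X p, Y p.2)) = ((μ.prod P).map X).prod (P.map Y) := by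
  refine (Measure.prod_eq fun A B hA hB => ?_).symm
  have hY' : Measurable fun p : α × Ω => Y p.2 := hY.comp measurable_snd
  rw [Measure.map_apply (hX.prodMk hY') (hA.prod hB), Measure.map_apply hX hA,
    Measure.map_apply hY hB, Measure.prod_apply ((hX.prodMk hY') (hA.prod hB)),
    Measure.prod_apply (hX hA),
    ← lintegral_mul_const _ (measurable_measure_prodMk_left (hX hA))]
  exact lintegral_congr fun x => (hXY x).measure_inter_preimage_eq_mul A B hA hB

section StateLaw

/-- The workload at the end of a period of length `r` without arrivals, starting from `w`. -/
def drain (w r : ℝ) : ℝ := max (w - r) 0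

/-- The workload just after the arrival of a customer with service requirement `s` who finds the
workload `y`. -/
noncomputable def accept (y s : ℝ) : ℝ := y + if y < 1 then s else 0

/-- The transition of the chain `(T_n, V_{T_n})`: from the state `a`, the next interarrival time
`b.1` and the next service requirement `b.2` lead to the state `nextState a b`. -/
noncomputable def nextState (a b : ℝ × ℝ) : ℝ × ℝ := (a.1 + b.1, accept (drain a.2 b.1) b.2)

lemma drain_drain (w r : ℝ) {s : ℝ} (hs : 0 ≤ s) : drain (drain w r) s = drain w (r + s) := by
  unfold drain
  rw [← max_sub_sub_right, max_assoc, max_eq_right (by linarith : 0 - s ≤ 0), sub_sub]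

variable {α Ω : Type*} {I S : ℕ → Ω → ℝ}

@[fun_prop]
lemma measurable_drain [MeasurableSpace α] {w r : α → ℝ} (hw : Measurable w)
    (hr : Measurable r) : Measurable fun a => drain (w a) (r a) :=
  (hw.sub hr).max measurable_const

@[fun_prop]
lemma measurable_accept [MeasurableSpace α] {y s : α → ℝ} (hy : Measurable y)
    (hs : Measurable s) : Measurable fun a => accept (y a) (s a) :=
  hy.add (Measurable.ite (measurableSet_lt hy measurable_const) hs measurable_const)

@[fun_prop]
lemma measurable_nextState [MeasurableSpace α] {a b : α → ℝ × ℝ} (ha : Measurable a)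
    (hb : Measurable b) : Measurable fun x => nextState (a x) (b x) := by
  unfold nextState
  fun_prop

/-- The state `(T_n, V_{T_n})` of the queue just after the `n`-th arrival, as a function of the
initial workload `p.1` and of the sample point `p.2`. -/
noncomputable def arrivalState (I S : ℕ → Ω → ℝ) (n : ℕ) (p : ℝ × Ω) : ℝ × ℝ :=
  (arrivalTime I n p.2, workloadAtArrival I S p.1 n p.2)

lemma arrivalTime_succ (n : ℕ) (ω : Ω) :
    arrivalTime I (n + 1) ω = arrivalTime I n ω + I n ω :=
  Finset.sum_range_succ _ _

lemma arrivalState_zero (p : ℝ × Ω) : arrivalState I S 0 p = (0, p.1) := by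
  simp [arrivalState, arrivalTime, workloadAtArrival]

lemma arrivalState_succ (n : ℕ) (p : ℝ × Ω) :
    arrivalState I S (n + 1) p = nextState (arrivalState I S n p) (I n p.2, S n p.2) :=
  Prod.ext (arrivalTime_succ n p.2) rfl

lemma measurable_arrivalState_comp [MeasurableSpace α] {q : α → ℝ × Ω} (n : ℕ)
    (hx : Measurable fun a => (q a).1) (hI : ∀ k < n, Measurable fun a => I k (q a).2)
    (hS : ∀ k < n, Measurable fun a => S k (q a).2) :
    Measurable fun a => arrivalState I S n (q a) := by
  induction n with
  | zero => simpa only [arrivalState_zero] using measurable_const.prodMk hx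
  | succ n ih =>
    simp only [arrivalState_succ]
    exact measurable_nextState (ih (fun k hk => hI k (by lia)) fun k hk => hS k (by lia))
      ((hI n (by lia)).prodMk (hS n (by lia)))

variable [MeasurableSpace Ω] {P : Measure Ω} {lam : ℝ} {G π : Measure ℝ}

namespace IsMG1Input

lemma measurable_arrivalState (h : IsMG1Input P lam G I S) (n : ℕ) :
    Measurable (arrivalState I S n) :=
  measurable_arrivalState_comp (q := id) n measurable_fst
    (fun k _ => (h.measurable_I k).comp measurable_snd)
    fun k _ => (h.measurable_S k).comp measurable_snd

lemma measurable_prodMk (h : IsMG1Input P lam G I S) (n : ℕ) :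
    Measurable fun ω => (I n ω, S n ω) :=
  (h.measurable_I n).prodMk (h.measurable_S n)

lemma indepFun_arrivalState (h : IsMG1Input P lam G I S) (x : ℝ) (n : ℕ) :
    IndepFun (fun ω => arrivalState I S n (x, ω)) (fun ω => (I n ω, S n ω)) P := by
  let m : ℕ ⊕ ℕ → MeasurableSpace Ω := fun i => MeasurableSpace.comap (Sum.elim I S i) inferInstance
  have hm : ∀ i, m i ≤ ‹MeasurableSpace Ω› := by
    rintro (k | k)
    · exact (h.measurable_I k).comap_le
    · exact (h.measurable_S k).comap_le
  let past : Set (ℕ ⊕ ℕ) := {i | Sum.elim id id i < n}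
  let present : Set (ℕ ⊕ ℕ) := {i | Sum.elim id id i = n}
  have h_indep : Indep (⨆ i ∈ past, m i) (⨆ i ∈ present, m i) P :=
    indep_iSup_of_disjoint hm h.indep (Set.disjoint_left.2 fun _ hi hi' => (ne_of_lt hi) hi')
  have h_meas : ∀ (C : Set (ℕ ⊕ ℕ)) i, i ∈ C →
      Measurable[⨆ j ∈ C, m j] (Sum.elim I S i : Ω → ℝ) := fun C i hi =>
    (comap_measurable _).mono (le_iSup₂_of_le i hi le_rfl) le_rfl
  refine indep_of_indep_of_le_left (indep_of_indep_of_le_right h_indep ?_) ?_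
  · exact ((h_meas present (Sum.inl n) rfl).prodMk (h_meas present (Sum.inr n) rfl)).comap_le
  · exact (@measurable_arrivalState_comp _ _ _ _ (⨆ i ∈ past, m i) (Prod.mk x) n
      (@measurable_const _ _ _ (⨆ i ∈ past, m i) x) (fun k hk => h_meas past (Sum.inl k) hk)
      fun k hk => h_meas past (Sum.inr k) hk).comap_le

lemma map_prodMk [IsFiniteMeasure P] (h : IsMG1Input P lam G I S) (n : ℕ) :
    P.map (fun ω => (I n ω, S n ω)) = (expMeasure lam).prod G := by
  have h_indep := h.indep.indepFun (i := Sum.inl n) (j := Sum.inr n) (by simp)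
  simpa only [Sum.elim_inl, Sum.elim_inr, h.law_I, h.law_S] using
    (indepFun_iff_map_prod_eq_prod_map_map (h.measurable_I n).aemeasurable
      (h.measurable_S n).aemeasurable).1 h_indep

lemma ae_nonneg (h : IsMG1Input P lam G I S) : ∀ᵐ ω ∂P, ∀ n, 0 ≤ I n ω :=
  ae_all_iff.2 fun n => ae_of_ae_map (h.measurable_I n).aemeasurable
    ((h.law_I n).symm ▸ ae_nonneg_expMeasure)

end IsMG1Input

/-- The joint law of the `n`-th arrival time and the workload just after it, when the initial
workload has law `π`. -/
noncomputable def stateLaw (P : Measure Ω) (I S : ℕ → Ω → ℝ) (π : Measure ℝ) (n : ℕ) :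
    Measure (ℝ × ℝ) :=
  (π.prod P).map (arrivalState I S n)

instance {n : ℕ} [SFinite P] [SFinite π] : SFinite (stateLaw P I S π n) := by
  unfold stateLaw; infer_instance

lemma stateLaw_zero [IsProbabilityMeasure P] [SFinite π] :
    stateLaw P I S π 0 = (Measure.dirac 0).prod π := by
  have h : arrivalState I S 0 = Prod.mk 0 ∘ Prod.fst := funext arrivalState_zero
  rw [stateLaw, h, ← Measure.map_map measurable_prodMk_left measurable_fst,
    Measure.map_fst_prod, measure_univ, one_smul, Measure.dirac_prod]

namespace IsMG1Input

lemma stateLaw_ae_nonneg [SFinite P] (h : IsMG1Input P lam G I S) (n : ℕ) :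
    ∀ᵐ a ∂stateLaw P I S π n, 0 ≤ a.1 := by
  refine (ae_map_iff (h.measurable_arrivalState n).aemeasurable
    (measurableSet_le measurable_const measurable_fst)).2 ?_
  filter_upwards [Measure.quasiMeasurePreserving_snd.ae h.ae_nonneg] with p hp
  exact Finset.sum_nonneg (s := Finset.range n) fun k _ => hp k

variable [IsProbabilityMeasure P] [SFinite G] [IsFiniteMeasure π]

lemma lintegral_arrivalState_prodMk (h : IsMG1Input P lam G I S) (n : ℕ)
    {F : (ℝ × ℝ) × (ℝ × ℝ) → ℝ≥0∞} (hF : Measurable F) :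
    ∫⁻ p, F (arrivalState I S n p, (I n p.2, S n p.2)) ∂π.prod P =
      ∫⁻ a, ∫⁻ u, ∫⁻ s, F (a, (u, s)) ∂G ∂expMeasure lam ∂stateLaw P I S π n := by
  have h_map := map_prodMk_snd_of_indepFun (μ := π) (h.measurable_arrivalState n)
    (h.measurable_prodMk n) fun x => h.indepFun_arrivalState x n
  have h_meas : Measurable fun p : ℝ × Ω => (arrivalState I S n p, (I n p.2, S n p.2)) :=
    (h.measurable_arrivalState n).prodMk ((h.measurable_prodMk n).comp measurable_snd)
  rw [← lintegral_map hF h_meas, h_map, h.map_prodMk, lintegral_prod _ hF.aemeasurable]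
  exact lintegral_congr fun a =>
    lintegral_prod (fun b => F (a, b)) (hF.comp measurable_prodMk_left).aemeasurable

lemma lintegral_stateLaw_succ (h : IsMG1Input P lam G I S) (n : ℕ) {F : ℝ × ℝ → ℝ≥0∞}
    (hF : Measurable F) :
    ∫⁻ a, F a ∂stateLaw P I S π (n + 1) =
      ∫⁻ a, ∫⁻ u, ∫⁻ s, F (nextState a (u, s)) ∂G ∂expMeasure lam ∂stateLaw P I S π n := by
  rw [stateLaw, lintegral_map hF (h.measurable_arrivalState _),
    ← h.lintegral_arrivalState_prodMk n (F := fun q => F (nextState q.1 q.2)) (by fun_prop)]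
  simp only [arrivalState_succ]

end IsMG1Input

end StateLaw

section WorkloadLaw

variable {Ω : Type*} {I S : ℕ → Ω → ℝ}

lemma arrivalTime_monotone {ω : Ω} (hI : ∀ n, 0 ≤ I n ω) :
    Monotone fun n => arrivalTime I n ω :=
  monotone_nat_of_le_succ fun n => by
    rw [arrivalTime_succ]
    exact le_add_of_nonneg_right (hI n)

lemma arrivalCount_eq_iff {ω : Ω} (hI : ∀ n, 0 ≤ I n ω)
    (hT : Filter.Tendsto (fun n => arrivalTime I n ω) Filter.atTop Filter.atTop) {t : ℝ}
    (ht : 0 ≤ t) (n : ℕ) :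
    arrivalCount I t ω = n ↔ arrivalTime I n ω ≤ t ∧ t < arrivalTime I n ω + I n ω := by
  have h_mono := arrivalTime_monotone hI
  have h_zero : arrivalTime I 0 ω ≤ t := by simpa [arrivalTime] using ht
  have h_bdd : BddAbove {m | arrivalTime I m ω ≤ t} := by
    obtain ⟨b, hb⟩ := (hT.eventually_gt_atTop t).exists
    exact ⟨b, fun m hm => le_of_not_ge fun hbm => (hm.trans_lt hb).not_ge (h_mono hbm)⟩
  rw [← arrivalTime_succ]
  constructor
  · rintro rfl
    exact ⟨Nat.sSup_mem ⟨0, h_zero⟩ h_bdd, not_le.1 fun h => (le_csSup h_bdd h).not_gt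
      (Nat.lt_succ_self _)⟩
  · rintro ⟨h_le, h_lt⟩
    exact IsGreatest.csSup_eq ⟨h_le, fun m hm => Nat.lt_succ_iff.1 (not_le.1 fun h =>
      (h_lt.trans_le (h_mono h)).not_ge hm)⟩

variable [MeasurableSpace Ω] {P : Measure Ω} {lam : ℝ} {G π : Measure ℝ}

lemma measurable_arrivalCount (hI : ∀ n, Measurable (I n)) (t : ℝ) :
    Measurable (arrivalCount I t) := by
  let bounded : ℕ → Set Ω := fun m => {ω | ∀ n, arrivalTime I n ω ≤ t → n ≤ m}
  have h_bounded : ∀ m, MeasurableSet (bounded m) := fun m =>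
    measurableSet_setOfPred.2 <| Measurable.forall fun n =>
      (measurableSet_setOfPred.1 (measurableSet_le
        (Finset.measurable_sum _ fun k _ => hI k) measurable_const)).imp measurable_const
  refine measurable_of_Iic fun m => ?_
  have h_preimage : arrivalCount I t ⁻¹' Iic m = bounded m ∪ (⋃ k, bounded k)ᶜ := by
    ext ω
    simp only [mem_preimage, mem_Iic, mem_union, mem_compl_iff, mem_iUnion]
    by_cases h : BddAbove {n | arrivalTime I n ω ≤ t}
    · have h' : ∃ k, ω ∈ bounded k := h
      simp only [h', not_true, or_false]
      exact csSup_le_iff' h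
    · have h' : ¬∃ k, ω ∈ bounded k := h
      simp [h', arrivalCount, Nat.sSup_of_not_bddAbove h]
  rw [h_preimage]
  exact (h_bounded m).union (MeasurableSet.iUnion h_bounded).compl

/-- The law of the workload at time `t`, when the initial workload has law `π`. -/
noncomputable def workloadLaw (P : Measure Ω) (I S : ℕ → Ω → ℝ) (π : Measure ℝ) (t : ℝ) :
    Measure ℝ :=
  (π.prod P).map fun p => workload I S p.1 t p.2

/-- For `ν` the law of the state `(T_n, V_{T_n})` just after the `n`-th arrival, this is the
expectation of `f (V_t)` on the event that the `n`-th arrival is the last one up to time `t`. -/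
noncomputable def lastArrivalIntegral (lam : ℝ) (ν : Measure (ℝ × ℝ)) (t : ℝ) (f : ℝ → ℝ≥0∞) :
    ℝ≥0∞ :=
  ∫⁻ a, survival lam (t - a.1) * f (drain a.2 (t - a.1)) ∂ν

namespace IsMG1Input

lemma measurable_workload (h : IsMG1Input P lam G I S) (t : ℝ) :
    Measurable fun p : ℝ × Ω => workload I S p.1 t p.2 := by
  have h_drain : Measurable fun q : ℕ × (ℝ × Ω) =>
      drain (arrivalState I S q.1 q.2).2 (t - (arrivalState I S q.1 q.2).1) :=
    measurable_from_prod_countable_right fun n =>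
      measurable_drain (h.measurable_arrivalState n).snd
        (measurable_const.sub (h.measurable_arrivalState n).fst)
  exact h_drain.comp (((measurable_arrivalCount h.measurable_I t).comp measurable_snd).prodMk
    measurable_id)

lemma isProbabilityMeasure_workloadLaw [IsProbabilityMeasure P] [IsProbabilityMeasure π]
    (h : IsMG1Input P lam G I S) (t : ℝ) : IsProbabilityMeasure (workloadLaw P I S π t) :=
  Measure.isProbabilityMeasure_map (h.measurable_workload t).aemeasurable

lemma workloadLaw_apply [SFinite P] (h : IsMG1Input P lam G I S) (t : ℝ) {A : Set ℝ}
    (hA : MeasurableSet A) :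
    workloadLaw P I S π t A = ∫⁻ x, P {ω | workload I S x t ω ∈ A} ∂π :=
  (Measure.map_apply (h.measurable_workload t) hA).trans
    (Measure.prod_apply (h.measurable_workload t hA))

lemma isInvariant_iff_workloadLaw [SFinite P] [IsProbabilityMeasure π]
    (h : IsMG1Input P lam G I S) :
    IsInvariant P I S π ↔ π (Iio 0) = 0 ∧ ∀ t, 0 ≤ t → workloadLaw P I S π t = π := by
  constructor
  · intro hπ
    exact ⟨hπ.nonneg, fun t ht => Measure.ext fun A hA =>
      (h.workloadLaw_apply t hA).trans (hπ.invariant t ht A hA)⟩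
  · rintro ⟨h_nonneg, h_law⟩
    exact ⟨inferInstance, h_nonneg, fun t ht A hA => by
      rw [← h.workloadLaw_apply t hA, h_law t ht]⟩

/-- By the second Borel-Cantelli lemma, infinitely many interarrival times exceed `1`. -/
lemma ae_tendsto_arrivalTime [IsProbabilityMeasure P] (h : IsMG1Input P lam G I S)
    (hlam : 0 < lam) :
    ∀ᵐ ω ∂P, Filter.Tendsto (fun n => arrivalTime I n ω) Filter.atTop Filter.atTop := by
  let long : ℕ → Set Ω := fun n => I n ⁻¹' Ioi 1
  have h_long : ∀ n, MeasurableSet (long n) := fun n => h.measurable_I n measurableSet_Ioi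
  have h_indep : iIndepSet long P := (iIndepSet_iff_meas_biInter h_long).2 fun s =>
    (h.indep.precomp Sum.inl_injective).measure_inter_preimage_eq_mul s
      fun _ _ => measurableSet_Ioi
  have h_sum : ∑' n, P (long n) = ∞ := by
    have h_const : ∀ n, P (long n) = survival lam 1 := fun n => by
      rw [← expMeasure_Ioi hlam zero_le_one, ← h.law_I n,
        Measure.map_apply (h.measurable_I n) measurableSet_Ioi]
    simp only [h_const]
    refine ENNReal.tsum_const_eq_top_of_ne_zero ?_
    simp [survival_of_nonneg, Real.exp_pos]
  have h_limsup : ∀ᵐ ω ∂P, ω ∈ Filter.limsup long Filter.atTop :=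
    (mem_ae_iff_prob_eq_one (MeasurableSet.measurableSet_limsup h_long)).2
      (measure_limsup_eq_one h_long h_indep h_sum)
  filter_upwards [h.ae_nonneg, h_limsup] with ω h_nonneg hω
  refine (not_summable_iff_tendsto_nat_atTop_of_nonneg h_nonneg).1 fun h_summable => ?_
  obtain ⟨n, h_gt, h_lt⟩ := ((Filter.mem_limsup_iff_frequently_mem.1 hω).and_eventually
    (h_summable.tendsto_atTop_zero.eventually_lt_const zero_lt_one)).exists
  exact lt_asymm h_gt h_lt

variable [IsProbabilityMeasure P] [IsProbabilityMeasure G] [IsFiniteMeasure π]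

lemma setLIntegral_arrivalState (h : IsMG1Input P lam G I S) (hlam : 0 < lam) (n : ℕ) (t : ℝ)
    {f : ℝ → ℝ≥0∞} (hf : Measurable f) :
    ∫⁻ p in {p | arrivalTime I n p.2 ≤ t ∧ t < arrivalTime I n p.2 + I n p.2},
        f (drain (workloadAtArrival I S p.1 n p.2) (t - arrivalTime I n p.2)) ∂π.prod P =
      lastArrivalIntegral lam (stateLaw P I S π n) t f := by
  let B : Set ((ℝ × ℝ) × ℝ × ℝ) := {q | q.1.1 ≤ t ∧ t < q.1.1 + q.2.1}
  let F : (ℝ × ℝ) × ℝ × ℝ → ℝ≥0∞ := fun q => f (drain q.1.2 (t - q.1.1))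
  have hB : MeasurableSet B :=
    (measurableSet_le measurable_fst.fst measurable_const).inter
      (measurableSet_lt measurable_const (measurable_fst.fst.add measurable_snd.fst))
  have hF : Measurable F := by fun_prop
  have h_last : Measurable fun p : ℝ × Ω => (arrivalState I S n p, (I n p.2, S n p.2)) :=
    (h.measurable_arrivalState n).prodMk ((h.measurable_prodMk n).comp measurable_snd)
  have h_inner : ∀ a u, ∫⁻ s, B.indicator F (a, (u, s)) ∂G =
      (Ioi (t - a.1)).indicator
        (fun _ => if a.1 ≤ t then f (drain a.2 (t - a.1)) else 0) u := by
    intro a u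
    by_cases h₁ : a.1 ≤ t <;> by_cases h₂ : t < a.1 + u <;>
      simp [B, F, indicator, sub_lt_iff_lt_add', h₁, h₂]
  refine (lintegral_indicator (h_last hB) _).symm.trans
    ((h.lintegral_arrivalState_prodMk n (hF.indicator hB)).trans (lintegral_congr fun a => ?_))
  simp only [h_inner]
  rw [lintegral_indicator_const measurableSet_Ioi]
  by_cases ha : a.1 ≤ t
  · rw [if_pos ha, expMeasure_Ioi hlam (sub_nonneg.2 ha), mul_comm]
  · rw [if_neg ha, survival_of_neg (sub_neg.2 (not_le.1 ha)), zero_mul, zero_mul]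

lemma lintegral_workloadLaw (h : IsMG1Input P lam G I S) (hlam : 0 < lam) {t : ℝ} (ht : 0 ≤ t)
    {f : ℝ → ℝ≥0∞} (hf : Measurable f) :
    ∫⁻ y, f y ∂workloadLaw P I S π t =
      ∑' n, lastArrivalIntegral lam (stateLaw P I S π n) t f := by
  have h_count : Measurable fun p : ℝ × Ω => arrivalCount I t p.2 :=
    (measurable_arrivalCount h.measurable_I t).comp measurable_snd
  have h_cover : ⋃ n, (fun p : ℝ × Ω => arrivalCount I t p.2) ⁻¹' {n} = univ :=
    iUnion_eq_univ_iff.2 fun p => ⟨_, rfl⟩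
  rw [workloadLaw, lintegral_map hf (h.measurable_workload t), ← setLIntegral_univ,
    ← h_cover, lintegral_iUnion (fun n => h_count (measurableSet_singleton n))
      (pairwise_disjoint_fiber fun p : ℝ × Ω => arrivalCount I t p.2)]
  refine tsum_congr fun n => ?_
  rw [← h.setLIntegral_arrivalState hlam n t hf]
  have h_event : (fun p : ℝ × Ω => arrivalCount I t p.2) ⁻¹' {n} =ᵐ[π.prod P]
      {p | arrivalTime I n p.2 ≤ t ∧ t < arrivalTime I n p.2 + I n p.2} := by
    filter_upwards [Measure.quasiMeasurePreserving_snd.ae h.ae_nonneg,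
      Measure.quasiMeasurePreserving_snd.ae (h.ae_tendsto_arrivalTime hlam)] with p hI hT
    exact propext (arrivalCount_eq_iff hI hT ht n)
  refine (setLIntegral_congr_fun (h_count (measurableSet_singleton n)) ?_).trans
    (setLIntegral_congr h_event)
  rintro p rfl
  rfl

end IsMG1Input

end WorkloadLaw

section Renewal

/-- The expectation of `f (V_v)` when a customer arrives at time `0`, finds the workload `y` and is
the only one to arrive up to time `v`. -/
noncomputable def afterArrival (G : Measure ℝ) (v : ℝ) (f : ℝ → ℝ≥0∞) (y : ℝ) : ℝ≥0∞ :=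
  ∫⁻ s, f (drain (accept y s) v) ∂G

variable {Ω : Type*} {I S : ℕ → Ω → ℝ} {lam : ℝ} {G π : Measure ℝ}

@[fun_prop]
lemma measurable_afterArrival {α : Type*} [MeasurableSpace α] [SFinite G] {f : ℝ → ℝ≥0∞}
    (hf : Measurable f) {v y : α → ℝ} (hv : Measurable v) (hy : Measurable y) :
    Measurable fun a => afterArrival G (v a) f (y a) :=
  Measurable.lintegral_prod_right (f := fun a s => f (drain (accept (y a) s) (v a)))
    (by unfold Function.uncurry; fun_prop)

lemma afterArrival_add (r : ℝ) {t : ℝ} (ht : 0 ≤ t) (f : ℝ → ℝ≥0∞) (y : ℝ) :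
    afterArrival G (r + t) f y = afterArrival G r (fun x => f (drain x t)) y := by
  simp only [afterArrival, drain_drain _ _ ht]

lemma afterArrival_mono (v : ℝ) {f g : ℝ → ℝ≥0∞} (hfg : f ≤ g) (y : ℝ) :
    afterArrival G v f y ≤ afterArrival G v g y :=
  lintegral_mono fun _ => hfg _

lemma measurable_lastArrivalIntegral [SFinite G] {ν : Measure (ℝ × ℝ)} [SFinite ν]
    {f : ℝ → ℝ≥0∞} (hf : Measurable f) (t : ℝ) :
    Measurable fun v => lastArrivalIntegral lam ν (t - v) (afterArrival G v f) :=
  Measurable.lintegral_prod_right (f := fun (v : ℝ) (a : ℝ × ℝ) =>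
    survival lam (t - v - a.1) * afterArrival G v f (drain a.2 (t - v - a.1)))
    (by unfold Function.uncurry; fun_prop)

variable [MeasurableSpace Ω] {P : Measure Ω}

lemma lastArrivalIntegral_stateLaw_zero [IsProbabilityMeasure P] [SFinite π] (lam t : ℝ)
    {f : ℝ → ℝ≥0∞} (hf : Measurable f) :
    lastArrivalIntegral lam (stateLaw P I S π 0) t f =
      survival lam t * ∫⁻ x, f (drain x t) ∂π := by
  rw [lastArrivalIntegral, stateLaw_zero, lintegral_prod _ (by fun_prop), lintegral_dirac]
  simp only [sub_zero]
  exact lintegral_const_mul _ (by fun_prop)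

namespace IsMG1Input

variable [IsProbabilityMeasure P] [IsFiniteMeasure π]

lemma lastArrivalIntegral_stateLaw_succ [SFinite G] (h : IsMG1Input P lam G I S) (n : ℕ) (t : ℝ)
    {f : ℝ → ℝ≥0∞} (hf : Measurable f) :
    lastArrivalIntegral lam (stateLaw P I S π (n + 1)) t f =
      ∫⁻ v, lastArrivalIntegral lam (stateLaw P I S π n) (t - v) (afterArrival G v f)
        ∂expMeasure lam := by
  have h_inner : ∀ a : ℝ × ℝ, ∫⁻ u, ∫⁻ s, survival lam (t - (a.1 + u)) *
        f (drain (accept (drain a.2 u) s) (t - (a.1 + u))) ∂G ∂expMeasure lam =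
      ∫⁻ v, survival lam (t - v - a.1) * afterArrival G v f (drain a.2 (t - v - a.1))
        ∂expMeasure lam := by
    intro a
    have h_reflect := lintegral_survival_sub_expMeasure (lam := lam) (t - a.1)
      (g := fun u => afterArrival G (t - a.1 - u) f (drain a.2 u)) (by fun_prop)
    simp only [sub_sub_cancel] at h_reflect
    simp only [sub_right_comm t _ a.1, ← h_reflect, ← sub_sub]
    exact lintegral_congr fun u => lintegral_const_mul _ (by fun_prop)
  rw [lastArrivalIntegral, h.lintegral_stateLaw_succ n (by fun_prop)]
  simp only [nextState, h_inner, lastArrivalIntegral]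
  exact lintegral_lintegral_swap (by fun_prop)

variable [IsProbabilityMeasure G]

/-- The renewal equation of the workload at the last arrival up to time `t`, which happens at the
time `t - v` with `v` exponentially distributed. -/
lemma lintegral_workloadLaw_eq_add (h : IsMG1Input P lam G I S) (hlam : 0 < lam) {t : ℝ}
    (ht : 0 ≤ t) {f : ℝ → ℝ≥0∞} (hf : Measurable f) :
    ∫⁻ y, f y ∂workloadLaw P I S π t =
      survival lam t * ∫⁻ x, f (drain x t) ∂π +
        ∫⁻ v in Iic t, ∫⁻ y, afterArrival G v f y ∂workloadLaw P I S π (t - v)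
          ∂expMeasure lam := by
  let K : ℕ → ℝ → ℝ≥0∞ := fun n v =>
    lastArrivalIntegral lam (stateLaw P I S π n) (t - v) (afterArrival G v f)
  have h_support : (fun v => ∑' n, K n v).support ⊆ Iic t := by
    intro v hv
    by_contra (htv : ¬v ≤ t)
    refine hv (ENNReal.tsum_eq_zero.2 fun n =>
      (lintegral_congr_ae ?_).trans (lintegral_zero (μ := stateLaw P I S π n)))
    filter_upwards [h.stateLaw_ae_nonneg (π := π) n] with a ha
    rw [survival_of_neg (by linarith [not_le.1 htv]), zero_mul]
  calc ∫⁻ y, f y ∂workloadLaw P I S π t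
      = lastArrivalIntegral lam (stateLaw P I S π 0) t f +
          ∑' n, lastArrivalIntegral lam (stateLaw P I S π (n + 1)) t f := by
        rw [h.lintegral_workloadLaw hlam ht hf, tsum_eq_zero_add' ENNReal.summable]
    _ = survival lam t * ∫⁻ x, f (drain x t) ∂π +
          ∫⁻ v in Iic t, ∑' n, K n v ∂expMeasure lam := by
        simp only [lastArrivalIntegral_stateLaw_zero lam t hf,
          h.lastArrivalIntegral_stateLaw_succ _ t hf, setLIntegral_eq_of_support_subset h_support]
        rw [lintegral_tsum fun n => (measurable_lastArrivalIntegral hf t).aemeasurable]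
    _ = _ := by
        congr 1
        refine setLIntegral_congr_fun measurableSet_Iic fun v hv => ?_
        exact (h.lintegral_workloadLaw hlam (sub_nonneg.2 hv) (by fun_prop)).symm

end IsMG1Input

/-- The law of the workload an exponential time after the arrival of a customer who finds a workload
of law `π`; this is the transition of the workloads just before the arrivals. -/
noncomputable def stepLaw (lam : ℝ) (G π : Measure ℝ) : Measure ℝ :=
  ((expMeasure lam).prod (π.prod G)).map fun p => drain (accept p.2.1 p.2.2) p.1

lemma isProbabilityMeasure_stepLaw (hlam : 0 < lam) [IsProbabilityMeasure G]
    [IsProbabilityMeasure π] : IsProbabilityMeasure (stepLaw lam G π) := by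
  have := isProbabilityMeasure_expMeasure hlam
  exact Measure.isProbabilityMeasure_map (by fun_prop)

variable [SFinite G] [SFinite π]

lemma lintegral_stepLaw {f : ℝ → ℝ≥0∞} (hf : Measurable f) :
    ∫⁻ y, f y ∂stepLaw lam G π =
      ∫⁻ v, ∫⁻ y, afterArrival G v f y ∂π ∂expMeasure lam := by
  rw [stepLaw, lintegral_map hf (by fun_prop), lintegral_prod _ (by fun_prop)]
  exact lintegral_congr fun v => lintegral_prod _ (by fun_prop)

lemma lintegral_stepLaw_eq_add {t : ℝ} (ht : 0 ≤ t) {f : ℝ → ℝ≥0∞} (hf : Measurable f) :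
    ∫⁻ y, f y ∂stepLaw lam G π =
      survival lam t * ∫⁻ x, f (drain x t) ∂stepLaw lam G π +
        ∫⁻ v in Iic t, ∫⁻ y, afterArrival G v f y ∂π ∂expMeasure lam := by
  have h_meas : Measurable fun v => ∫⁻ y, afterArrival G v f y ∂π :=
    Measurable.lintegral_prod_right (f := fun v y => afterArrival G v f y)
      (by unfold Function.uncurry; fun_prop)
  rw [lintegral_stepLaw hf, lintegral_stepLaw (by fun_prop),
    ← lintegral_add_compl _ (measurableSet_Iic (a := t)), compl_Iic, add_comm,
    setLIntegral_Ioi_expMeasure ht h_meas]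
  simp only [afterArrival_add _ ht]

end Renewal

section Invariance

variable {Ω : Type*} {I S : ℕ → Ω → ℝ} [MeasurableSpace Ω] {P : Measure Ω} {lam : ℝ}
  {G π : Measure ℝ}

lemma drain_nonneg (w r : ℝ) : 0 ≤ drain w r := le_max_right _ _

lemma stepLaw_Iio_zero : stepLaw lam G π (Iio 0) = 0 := by
  rw [stepLaw, Measure.map_apply (by fun_prop) measurableSet_Iio]
  exact (congrArg _ (eq_empty_of_forall_notMem fun p hp => (drain_nonneg _ _).not_gt hp)).trans
    measure_empty

lemma expMeasure_Iic_lt_one (hlam : 0 < lam) {t : ℝ} (ht : 0 ≤ t) : expMeasure lam (Iic t) < 1 := by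
  have := isProbabilityMeasure_expMeasure hlam
  rw [← compl_Ioi, prob_compl_eq_one_sub measurableSet_Ioi, expMeasure_Ioi hlam ht,
    survival_of_nonneg ht]
  exact ENNReal.sub_lt_self ENNReal.one_ne_top one_ne_zero (by simp [Real.exp_pos])

namespace IsMG1Input

variable [IsProbabilityMeasure P] [IsProbabilityMeasure G] [IsProbabilityMeasure π]

lemma eq_stepLaw_of_workloadLaw_eq (h : IsMG1Input P lam G I S) (hlam : 0 < lam)
    (hπ : ∀ t, 0 ≤ t → workloadLaw P I S π t = π) : π = stepLaw lam G π := by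
  have := isProbabilityMeasure_stepLaw (G := G) (π := π) hlam
  refine Measure.eq_of_le_of_isProbabilityMeasure (Measure.le_iff.2 fun A hA => ?_)
  let f : ℝ → ℝ≥0∞ := A.indicator 1
  have hf : Measurable f := measurable_one.indicator hA
  have hf_le : ∀ x, f x ≤ 1 := fun x => indicator_le_self' (by simp) x
  have h_le : ∀ t, 0 ≤ t → π A ≤ survival lam t + stepLaw lam G π A := by
    intro t ht
    have h_law : EqOn (fun v => ∫⁻ y, afterArrival G v f y ∂workloadLaw P I S π (t - v))
        (fun v => ∫⁻ y, afterArrival G v f y ∂π) (Iic t) := fun v hv => by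
      simp only [hπ _ (sub_nonneg.2 hv)]
    have h_renewal := h.lintegral_workloadLaw_eq_add (π := π) hlam ht hf
    rw [hπ t ht, setLIntegral_congr_fun measurableSet_Iic h_law] at h_renewal
    rw [← lintegral_indicator_one hA, h_renewal, ← lintegral_indicator_one hA,
      lintegral_stepLaw hf]
    gcongr
    · exact mul_le_of_le_one_right' ((lintegral_mono fun x => hf_le _).trans (by simp))
    · exact Measure.restrict_le_self
  refine ge_of_tendsto (by simpa using (tendsto_survival_atTop hlam).add_const _)
    ((Filter.eventually_ge_atTop 0).mono h_le)

/-- The renewal equation is a contraction on the time interval `[0, T]`. -/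
lemma lintegral_workloadLaw_le_add_pow (h : IsMG1Input P lam G I S) (hlam : 0 < lam)
    (hπ : π = stepLaw lam G π) {t T : ℝ} (ht : t ∈ Icc 0 T) (n : ℕ) {f : ℝ → ℝ≥0∞}
    (hf : Measurable f) (hf_le : f ≤ 1) :
    ∫⁻ y, f y ∂workloadLaw P I S π t ≤ ∫⁻ y, f y ∂π + expMeasure lam (Iic T) ^ n := by
  induction n generalizing t f with
  | zero =>
    have := h.isProbabilityMeasure_workloadLaw (π := π) t
    exact (lintegral_mono hf_le).trans (by simp)
  | succ n ih =>
    have h_step : ∀ᵐ v ∂expMeasure lam, v ∈ Iic t →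
        ∫⁻ y, afterArrival G v f y ∂workloadLaw P I S π (t - v) ≤
          ∫⁻ y, afterArrival G v f y ∂π + expMeasure lam (Iic T) ^ n := by
      filter_upwards [ae_nonneg_expMeasure] with v hv hvt
      exact ih ⟨sub_nonneg.2 hvt, by linarith [ht.2]⟩ (by fun_prop) fun y =>
        (afterArrival_mono v hf_le y).trans (by simp [afterArrival])
    have h_split := lintegral_stepLaw_eq_add (lam := lam) (G := G) (π := π) ht.1 hf
    rw [← hπ] at h_split
    rw [h.lintegral_workloadLaw_eq_add hlam ht.1 hf, h_split, add_assoc]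
    gcongr
    refine (setLIntegral_mono_ae' measurableSet_Iic h_step).trans ?_
    rw [lintegral_add_right _ measurable_const, setLIntegral_const, pow_succ]
    gcongr
    exact ht.2

lemma workloadLaw_eq_of_eq_stepLaw (h : IsMG1Input P lam G I S) (hlam : 0 < lam)
    (hπ : π = stepLaw lam G π) {t : ℝ} (ht : 0 ≤ t) : workloadLaw P I S π t = π := by
  have := h.isProbabilityMeasure_workloadLaw (π := π) t
  refine Measure.eq_of_le_of_isProbabilityMeasure (Measure.le_iff.2 fun A hA => ?_)
  have h_pow : Filter.Tendsto (fun n => π A + expMeasure lam (Iic t) ^ n) Filter.atTop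
      (nhds (π A)) := by
    simpa using tendsto_const_nhds.add
      (ENNReal.tendsto_pow_atTop_nhds_zero_of_lt_one (expMeasure_Iic_lt_one hlam ht))
  refine ge_of_tendsto' h_pow fun n => ?_
  simpa only [lintegral_indicator_one hA] using h.lintegral_workloadLaw_le_add_pow hlam hπ
    ⟨ht, le_rfl⟩ n (measurable_one.indicator hA) (indicator_le_self' (by simp))

lemma isInvariant_iff_eq_stepLaw (h : IsMG1Input P lam G I S) (hlam : 0 < lam) :
    IsInvariant P I S π ↔ π = stepLaw lam G π := by
  rw [h.isInvariant_iff_workloadLaw]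
  constructor
  · exact fun hπ => h.eq_stepLaw_of_workloadLaw_eq hlam hπ.2
  · intro hπ
    exact ⟨by rw [hπ, stepLaw_Iio_zero], fun t ht => h.workloadLaw_eq_of_eq_stepLaw hlam hπ ht⟩

end IsMG1Input

end Invariance

section HalfLines

variable {μ ν : Measure ℝ} {a : ℝ}

lemma ae_nonneg_of_measure_Iio_zero (hμ : μ (Iio 0) = 0) : ∀ᵐ x ∂μ, 0 ≤ x :=
  (measure_eq_zero_iff_ae_notMem.1 hμ).mono fun _ hx => not_lt.1 hx

lemma ext_of_measure_Ioi [IsFiniteMeasure μ] (h_univ : μ univ = ν univ)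
    (h : ∀ y, μ (Ioi y) = ν (Ioi y)) : μ = ν := by
  refine ext_of_generate_finite (range Ioi) ?_ isPiSystem_Ioi ?_ h_univ
  · rw [← borel_eq_generateFrom_Ioi]
    exact BorelSpace.measurable_eq
  · rintro _ ⟨y, rfl⟩
    exact h y

lemma restrict_Ioi_eq_restrict_Ioi_iff [IsFiniteMeasure (μ.restrict (Ioi a))] :
    μ.restrict (Ioi a) = ν.restrict (Ioi a) ↔ ∀ y, a ≤ y → μ (Ioi y) = ν (Ioi y) := by
  constructor
  · intro h y hy
    rw [← Measure.restrict_eq_self μ (Ioi_subset_Ioi hy), h,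
      Measure.restrict_eq_self ν (Ioi_subset_Ioi hy)]
  · intro h
    refine ext_of_measure_Ioi (by simpa using h a le_rfl) fun y => ?_
    rw [Measure.restrict_apply measurableSet_Ioi, Measure.restrict_apply measurableSet_Ioi,
      Ioi_inter_Ioi]
    exact h _ le_sup_right

lemma eq_iff_measure_Ioi_of_Iio_eq_zero [IsProbabilityMeasure μ] [IsProbabilityMeasure ν]
    (hμ : μ (Iio a) = 0) (hν : ν (Iio a) = 0) :
    μ = ν ↔ ∀ y, a ≤ y → μ (Ioi y) = ν (Ioi y) := by
  refine ⟨fun h y _ => by rw [h], fun h => ext_of_measure_Ioi (by simp) fun y => ?_⟩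
  rcases le_or_gt a y with hy | hy
  · exact h y hy
  · have h_one : ∀ ρ : Measure ℝ, IsProbabilityMeasure ρ → ρ (Iio a) = 0 → ρ (Ioi y) = 1 :=
      fun ρ _ hρ => (prob_compl_eq_zero_iff measurableSet_Ioi).1 <|
        measure_mono_null (by rw [compl_Ioi]; exact Iic_subset_Iio.2 hy) hρ
    rw [h_one μ inferInstance hμ, h_one ν inferInstance hν]

lemma withDensity_restrict_left_inj {s : Set ℝ} (hs : MeasurableSet s) {f : ℝ → ℝ≥0∞}
    (hf : Measurable f) (hf_zero : ∀ x ∈ s, f x ≠ 0) (hf_top : ∀ x ∈ s, f x ≠ ∞) :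
    (μ.withDensity f).restrict s = (ν.withDensity f).restrict s ↔
      μ.restrict s = ν.restrict s := by
  have h_inv (ρ : Measure ℝ) :
      ((ρ.withDensity f).restrict s).withDensity (fun x => (f x)⁻¹) = ρ.restrict s := by
    rw [restrict_withDensity hs]
    exact withDensity_inv_same hf (ae_restrict_of_forall_mem hs hf_zero)
      (ae_restrict_of_forall_mem hs hf_top)
  constructor
  · intro h
    rw [← h_inv μ, h, h_inv ν]
  · intro h
    rw [restrict_withDensity hs, restrict_withDensity hs, h]

end HalfLines

section Upcrossing

/-- For workload of law `π`, the probability that an arriving customer is admitted and lifts the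
workload from at most `z` to above `z`. -/
noncomputable def upcrossing (G π : Measure ℝ) (z : ℝ) : ℝ≥0∞ :=
  ∫⁻ x in Iio 1, (Iic z).indicator (fun x => G (Ioi (z - x))) x ∂π

variable {G π : Measure ℝ}

@[fun_prop]
lemma measurable_measure_Ioi : Measurable fun z => G (Ioi z) :=
  Antitone.measurable fun _ _ h => measure_mono (Ioi_subset_Ioi h)

lemma measurable_indicator_measure_Ioi :
    Measurable fun p : ℝ × ℝ => (Iic p.1).indicator (fun x => G (Ioi (p.1 - x))) p.2 :=
  Measurable.indicator (s := {p : ℝ × ℝ | p.2 ≤ p.1})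
    (measurable_measure_Ioi.comp (measurable_fst.sub measurable_snd))
    (measurableSet_le measurable_snd measurable_fst)

@[fun_prop]
lemma measurable_upcrossing [SFinite π] : Measurable (upcrossing G π) :=
  measurable_indicator_measure_Ioi.lintegral_prod_right'

lemma upcrossing_le_one [IsProbabilityMeasure G] [IsProbabilityMeasure π] (z : ℝ) :
    upcrossing G π z ≤ 1 :=
  calc upcrossing G π z ≤ ∫⁻ _ in Iio 1, 1 ∂π :=
        lintegral_mono fun x => (indicator_le_self' (fun _ _ => zero_le) x).trans prob_le_one
    _ ≤ 1 := by simpa using prob_le_one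

lemma upcrossing_smul (c : ℝ≥0∞) (z : ℝ) : upcrossing G (c • π) z = c * upcrossing G π z := by
  rw [upcrossing, Measure.restrict_smul, lintegral_smul_measure, smul_eq_mul, upcrossing]

lemma lintegral_mul_upcrossing [SFinite π] {φ : ℝ → ℝ≥0∞} (hφ : Measurable φ) :
    ∫⁻ z, φ z * upcrossing G π z =
      ∫⁻ x in Iio 1, (∫⁻ z in Ici x, φ z * G (Ioi (z - x))) ∂π := by
  have h_meas : Measurable fun p : ℝ × ℝ =>
      φ p.1 * (Iic p.1).indicator (fun x => G (Ioi (p.1 - x))) p.2 :=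
    (hφ.comp measurable_fst).mul measurable_indicator_measure_Ioi
  calc ∫⁻ z, φ z * upcrossing G π z
      = ∫⁻ z, ∫⁻ x in Iio 1, φ z * (Iic z).indicator (fun x => G (Ioi (z - x))) x ∂π :=
        lintegral_congr fun z => (lintegral_const_mul _
          (measurable_indicator_measure_Ioi.comp measurable_prodMk_left)).symm
    _ = ∫⁻ x in Iio 1, (∫⁻ z, φ z * (Iic z).indicator (fun x => G (Ioi (z - x))) x) ∂π :=
        lintegral_lintegral_swap h_meas.aemeasurable
    _ = ∫⁻ x in Iio 1, (∫⁻ z in Ici x, φ z * G (Ioi (z - x))) ∂π := by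
        refine lintegral_congr fun x => ?_
        rw [← lintegral_indicator measurableSet_Ici]
        refine lintegral_congr fun z => ?_
        by_cases hz : x ≤ z <;> simp [hz]

lemma lintegral_setLIntegral_Ico_add [SFinite G] {φ : ℝ → ℝ≥0∞} (hφ : Measurable φ) (x : ℝ) :
    ∫⁻ s, (∫⁻ z in Ico x (x + s), φ z) ∂G = ∫⁻ z in Ici x, φ z * G (Ioi (z - x)) := by
  have h_meas : Measurable fun p : ℝ × ℝ => (Ico x (x + p.1)).indicator φ p.2 :=
    (hφ.comp measurable_snd).indicator (s := {p : ℝ × ℝ | p.2 ∈ Ico x (x + p.1)})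
      ((measurableSet_le measurable_const measurable_snd).inter
        (measurableSet_lt measurable_snd (by fun_prop)))
  simp only [← lintegral_indicator measurableSet_Ico, ← lintegral_indicator measurableSet_Ici]
  rw [lintegral_lintegral_swap h_meas.aemeasurable]
  refine lintegral_congr fun z => ?_
  by_cases hz : x ≤ z
  · have h_indicator (s : ℝ) : (Ico x (x + s)).indicator φ z =
        (Ioi (z - x)).indicator (fun _ => φ z) s := by
      simp only [indicator, mem_Ico, hz, true_and, mem_Ioi, sub_lt_iff_lt_add']
    simp only [h_indicator]
    rw [lintegral_indicator_const measurableSet_Ioi, indicator_of_mem (mem_Ici.2 hz)]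
  · simp [hz]

end Upcrossing

section LevelCrossing

variable {lam : ℝ} {G π : Measure ℝ}

lemma expMeasure_Iio_sub (c y : ℝ) : expMeasure lam (Iio (c - y)) =
    ENNReal.ofReal lam * ∫⁻ z in Iio c, survival lam (z - y) := by
  rw [expMeasure_apply measurableSet_Iio, ← lintegral_indicator measurableSet_Iio,
    ← lintegral_indicator measurableSet_Iio, ← lintegral_sub_right_eq_self _ y]
  simp only [indicator, mem_Iio, sub_lt_sub_iff_right]

lemma expMeasure_Iio_of_nonpos {c : ℝ} (hc : c ≤ 0) : expMeasure lam (Iio c) = 0 :=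
  measure_mono_null (fun _ hu => not_le.2 (lt_of_lt_of_le hu hc)) ae_nonneg_expMeasure

lemma expMeasure_Ici (hlam : 0 < lam) {c : ℝ} (hc : 0 ≤ c) :
    expMeasure lam (Ici c) = survival lam c := by
  have h_ac : expMeasure lam ≪ volume := withDensity_absolutelyContinuous _ _
  rw [← expMeasure_Ioi hlam hc]
  exact measure_congr (h_ac.ae_eq Ioi_ae_eq_Ici.symm)

lemma measure_Ioi_eq_add (hlam : 0 < lam) (y : ℝ) :
    π (Ioi y) = ∫⁻ x, expMeasure lam (Iio (x - y)) ∂π +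
      ∫⁻ x in Ioi y, survival lam (x - y) ∂π := by
  have := isProbabilityMeasure_expMeasure hlam
  rw [← lintegral_indicator_one measurableSet_Ioi, ← lintegral_indicator measurableSet_Ioi,
    ← lintegral_add_right _ (Measurable.indicator (by fun_prop) measurableSet_Ioi)]
  refine lintegral_congr fun x => ?_
  rcases lt_or_ge y x with hx | hx
  · rw [indicator_of_mem (mem_Ioi.2 hx), indicator_of_mem (mem_Ioi.2 hx),
      ← expMeasure_Ici hlam (sub_nonneg.2 hx.le), ← compl_Iio,
      prob_add_prob_compl measurableSet_Iio, Pi.one_apply]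
  · rw [indicator_of_notMem (notMem_Ioi.2 hx), indicator_of_notMem (notMem_Ioi.2 hx),
      expMeasure_Iio_of_nonpos (sub_nonpos.2 hx), add_zero]

lemma lt_drain_iff {w r y : ℝ} (hy : 0 ≤ y) : y < drain w r ↔ r < w - y := by
  rw [drain, lt_max_iff, or_iff_left hy.not_gt, lt_sub_comm]

lemma stepLaw_Ioi_eq_lintegral (hlam : 0 < lam) [SFinite G] [SFinite π] {y : ℝ} (hy : 0 ≤ y) :
    stepLaw lam G π (Ioi y) = ∫⁻ x, ∫⁻ s, expMeasure lam (Iio (accept x s - y)) ∂G ∂π := by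
  have := isProbabilityMeasure_expMeasure hlam
  have h_meas : MeasurableSet
      ((fun p : ℝ × ℝ × ℝ => drain (accept p.2.1 p.2.2) p.1) ⁻¹' Ioi y) :=
    measurableSet_preimage (by fun_prop) measurableSet_Ioi
  rw [stepLaw, Measure.map_apply (by fun_prop) measurableSet_Ioi, Measure.prod_apply_symm h_meas,
    lintegral_prod _ (measurable_measure_prodMk_right h_meas).aemeasurable]
  refine lintegral_congr fun x => lintegral_congr fun s => congrArg _ (ext fun v => ?_)
  exact lt_drain_iff hy

lemma lintegral_expMeasure_Iio_add [IsProbabilityMeasure G] (hG : G (Iio 0) = 0) (x y : ℝ) :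
    ∫⁻ s, expMeasure lam (Iio (x + s - y)) ∂G = expMeasure lam (Iio (x - y)) +
      ENNReal.ofReal lam * ∫⁻ z in Ici x, survival lam (z - y) * G (Ioi (z - x)) := by
  have h_split : ∀ᵐ s ∂G, expMeasure lam (Iio (x + s - y)) = expMeasure lam (Iio (x - y)) +
      ENNReal.ofReal lam * ∫⁻ z in Ico x (x + s), survival lam (z - y) := by
    filter_upwards [ae_nonneg_of_measure_Iio_zero hG] with s hs
    rw [expMeasure_Iio_sub, expMeasure_Iio_sub, ← mul_add,
      ← Iio_union_Ico_eq_Iio (le_add_of_nonneg_right hs),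
      lintegral_union measurableSet_Ico (Iio_disjoint_Ici le_rfl |>.mono_right Ico_subset_Ici_self)]
  rw [lintegral_congr_ae h_split, lintegral_add_left measurable_const,
    lintegral_const_mul' _ _ ENNReal.ofReal_ne_top, lintegral_setLIntegral_Ico_add (by fun_prop)]
  simp

lemma stepLaw_Ioi [IsProbabilityMeasure G] [SFinite π] (hlam : 0 < lam) (hG : G (Iio 0) = 0)
    {y : ℝ} (hy : 0 ≤ y) :
    stepLaw lam G π (Ioi y) = ∫⁻ x, expMeasure lam (Iio (x - y)) ∂π +
      ENNReal.ofReal lam * ∫⁻ z, survival lam (z - y) * upcrossing G π z := by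
  have h_accept (x : ℝ) : ∫⁻ s, expMeasure lam (Iio (accept x s - y)) ∂G =
      expMeasure lam (Iio (x - y)) + (Iio 1).indicator (fun x => ENNReal.ofReal lam *
        ∫⁻ z in Ici x, survival lam (z - y) * G (Ioi (z - x))) x := by
    by_cases hx : x < 1
    · simp only [accept, hx, if_true, indicator_of_mem (mem_Iio.2 hx),
        lintegral_expMeasure_Iio_add hG]
    · simp [accept, hx]
  have h_meas : Measurable fun x => expMeasure lam (Iio (x - y)) :=
    Monotone.measurable fun _ _ h => measure_mono (Iio_subset_Iio (sub_le_sub_right h y))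
  rw [stepLaw_Ioi_eq_lintegral hlam hy]
  simp only [h_accept]
  rw [lintegral_add_left h_meas, lintegral_indicator measurableSet_Iio,
    lintegral_const_mul' _ _ ENNReal.ofReal_ne_top, lintegral_mul_upcrossing (by fun_prop)]

lemma survival_ne_zero {r : ℝ} (hr : 0 ≤ r) : survival lam r ≠ 0 := by
  simpa [survival_of_nonneg hr] using Real.exp_pos _

lemma survival_ne_top (r : ℝ) : survival lam r ≠ ∞ := by
  rw [survival]
  split_ifs <;> simp

lemma survival_le_one (hlam : 0 ≤ lam) (r : ℝ) : survival lam r ≤ 1 := by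
  rw [survival]
  split_ifs with hr
  · simpa using mul_nonneg hlam hr
  · exact zero_le

lemma measure_Ioi_eq_stepLaw_Ioi_iff [IsProbabilityMeasure G] [IsProbabilityMeasure π]
    (hlam : 0 < lam) (hG : G (Iio 0) = 0) {y : ℝ} (hy : 0 ≤ y) :
    π (Ioi y) = stepLaw lam G π (Ioi y) ↔ ∫⁻ x in Ioi y, survival lam x ∂π =
      ∫⁻ z in Ioi y, survival lam z * (ENNReal.ofReal lam * upcrossing G π z) := by
  have := isProbabilityMeasure_expMeasure hlam
  have h_fin : ∫⁻ x, expMeasure lam (Iio (x - y)) ∂π ≠ ∞ :=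
    ((lintegral_mono fun x => prob_le_one).trans_lt (by simp)).ne
  have h_shift {x : ℝ} (hx : x ∈ Ioi y) :
      survival lam x = survival lam y * survival lam (x - y) := by
    rw [← survival_add hy (sub_nonneg.2 (mem_Ioi.1 hx).le), add_sub_cancel]
  have h_left : ∫⁻ x in Ioi y, survival lam x ∂π =
      survival lam y * ∫⁻ x in Ioi y, survival lam (x - y) ∂π := by
    rw [setLIntegral_congr_fun measurableSet_Ioi fun x hx => h_shift hx,
      lintegral_const_mul _ (by fun_prop)]
  have h_right : ∫⁻ z in Ioi y, survival lam z * (ENNReal.ofReal lam * upcrossing G π z) =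
      survival lam y * (ENNReal.ofReal lam * ∫⁻ z, survival lam (z - y) * upcrossing G π z) := by
    have h_Ici : ∫⁻ z, survival lam (z - y) * upcrossing G π z =
        ∫⁻ z in Ioi y, survival lam (z - y) * upcrossing G π z := by
      rw [setLIntegral_congr Ioi_ae_eq_Ici, ← lintegral_indicator measurableSet_Ici]
      refine congrArg _ (indicator_eq_self.2 fun z hz => by_contra fun hzy => hz ?_).symm
      rw [survival_of_neg (sub_neg.2 (not_le.1 hzy)), zero_mul]
    rw [h_Ici, ← lintegral_const_mul _ (by fun_prop), ← lintegral_const_mul _ (by fun_prop)]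
    refine setLIntegral_congr_fun measurableSet_Ioi fun z hz => ?_
    simp only [h_shift hz]
    ring
  rw [stepLaw_Ioi hlam hG hy, measure_Ioi_eq_add hlam y, ENNReal.add_right_inj h_fin, h_left,
    h_right, ENNReal.mul_right_inj (survival_ne_zero hy) (survival_ne_top y)]

/-- The level crossing identity of the stationary queue: the density at `z > 0`, which is the rate
of downcrossings of `z`, equals the rate of upcrossings of `z`. -/
def LevelCrossing (lam : ℝ) (G π : Measure ℝ) : Prop :=
  π.restrict (Ioi 0) =
    (volume.restrict (Ioi 0)).withDensity fun z => ENNReal.ofReal lam * upcrossing G π z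

lemma LevelCrossing.smul [SFinite π] (h : LevelCrossing lam G π) (c : ℝ≥0∞) :
    LevelCrossing lam G (c • π) := by
  have h_density : (fun z => ENNReal.ofReal lam * upcrossing G (c • π) z) =
      c • fun z => ENNReal.ofReal lam * upcrossing G π z := by
    ext z
    simp only [upcrossing_smul, Pi.smul_apply, smul_eq_mul, mul_left_comm]
  rw [LevelCrossing, Measure.restrict_smul, h, h_density, withDensity_smul _ (by fun_prop)]

lemma eq_stepLaw_iff_levelCrossing [IsProbabilityMeasure G] [IsProbabilityMeasure π]
    (hlam : 0 < lam) (hG : G (Iio 0) = 0) (hπ : π (Iio 0) = 0) :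
    π = stepLaw lam G π ↔ LevelCrossing lam G π := by
  have := isProbabilityMeasure_stepLaw (G := G) (π := π) hlam
  let ν : Measure ℝ := volume.withDensity fun z => ENNReal.ofReal lam * upcrossing G π z
  have h_fin : IsFiniteMeasure (π.withDensity (survival lam)) :=
    isFiniteMeasure_withDensity
      ((lintegral_mono (survival_le_one hlam.le)).trans_lt (by simp)).ne
  have h_ν (y : ℝ) : ν.withDensity (survival lam) (Ioi y) =
      ∫⁻ z in Ioi y, survival lam z * (ENNReal.ofReal lam * upcrossing G π z) := by
    rw [← withDensity_mul _ (by fun_prop) measurable_survival,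
      withDensity_apply _ measurableSet_Ioi]
    simp only [Pi.mul_apply, mul_comm]
  calc π = stepLaw lam G π
      ↔ ∀ y, 0 ≤ y → π (Ioi y) = stepLaw lam G π (Ioi y) :=
        eq_iff_measure_Ioi_of_Iio_eq_zero hπ stepLaw_Iio_zero
    _ ↔ ∀ y, 0 ≤ y →
          π.withDensity (survival lam) (Ioi y) = ν.withDensity (survival lam) (Ioi y) :=
        forall₂_congr fun y hy => by
          rw [measure_Ioi_eq_stepLaw_Ioi_iff hlam hG hy, h_ν,
            withDensity_apply _ measurableSet_Ioi]
    _ ↔ (π.withDensity (survival lam)).restrict (Ioi 0) =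
          (ν.withDensity (survival lam)).restrict (Ioi 0) :=
        restrict_Ioi_eq_restrict_Ioi_iff.symm
    _ ↔ π.restrict (Ioi 0) = ν.restrict (Ioi 0) :=
        withDensity_restrict_left_inj measurableSet_Ioi measurable_survival
          (fun _ hx => survival_ne_zero (mem_Ioi.1 hx).le) (fun x _ => survival_ne_top x)
    _ ↔ LevelCrossing lam G π := by
        rw [LevelCrossing, restrict_withDensity measurableSet_Ioi]

end LevelCrossing

section Volterra

lemma measurable_intervalIntegral {F : ℝ × ℝ → ℝ} (hF : Measurable F) {a b : ℝ → ℝ}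
    (ha : Measurable a) (hb : Measurable b) : Measurable fun x => ∫ y in a x..b x, F (x, y) := by
  have h_Ioc {a b : ℝ → ℝ} (ha : Measurable a) (hb : Measurable b) :
      Measurable fun x => ∫ y in Ioc (a x) (b x), F (x, y) := by
    have h_set : MeasurableSet {p : ℝ × ℝ | p.2 ∈ Ioc (a p.1) (b p.1)} :=
      (measurableSet_lt (ha.comp measurable_fst) measurable_snd).inter
        (measurableSet_le measurable_snd (hb.comp measurable_fst))
    simp only [← integral_indicator measurableSet_Ioc]
    exact (hF.indicator h_set).stronglyMeasurable.integral_prod_right'.measurable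
  exact (h_Ioc ha hb).sub (h_Ioc hb ha)

variable {k g : ℝ → ℝ} {x b C lam : ℝ}

lemma abs_integral_mul_le_pow_succ_div_factorial (hk : ∀ y, |k y| ≤ 1) (hx : 0 ≤ x) {n : ℕ}
    (hg : ∀ y ∈ Ioc 0 x, |g y| ≤ C * (y ^ n / n.factorial)) :
    |∫ y in (0 : ℝ)..x, k (x - y) * g y| ≤ C * (x ^ (n + 1) / (n + 1).factorial) :=
  calc |∫ y in (0 : ℝ)..x, k (x - y) * g y|
      ≤ ∫ y in (0 : ℝ)..x, C * (y ^ n / n.factorial) := by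
        have h_cont : Continuous fun y : ℝ => C * (y ^ n / n.factorial) := by fun_prop
        refine intervalIntegral.norm_integral_le_of_norm_le (f := fun y => k (x - y) * g y) hx
          (.of_forall fun y hy => ?_) (h_cont.intervalIntegrable 0 x)
        rw [norm_mul]
        exact (mul_le_of_le_one_left (norm_nonneg _) (hk _)).trans (hg y hy)
    _ = C * (x ^ (n + 1) / (n + 1).factorial) := by
        rw [intervalIntegral.integral_const_mul, intervalIntegral.integral_div, integral_pow,
          zero_pow (Nat.succ_ne_zero n), sub_zero, div_div, Nat.factorial_succ]
        push_cast
        rfl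

lemma eq_zero_of_volterra (hk : ∀ y, |k y| ≤ 1) (hC : ∀ y ∈ Ioc 0 b, |g y| ≤ C)
    (hg : ∀ z ∈ Ioc 0 b, g z = lam * ∫ y in (0 : ℝ)..z, k (z - y) * g y) :
    ∀ z ∈ Ioc 0 b, g z = 0 := by
  have h_iterate (n : ℕ) : ∀ z ∈ Ioc 0 b, |g z| ≤ C * |lam| ^ n * (z ^ n / n.factorial) := by
    induction n with
    | zero => simpa using hC
    | succ n ih =>
      intro z hz
      have h_int := abs_integral_mul_le_pow_succ_div_factorial hk hz.1.le (n := n)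
        fun y hy => ih y ⟨hy.1, hy.2.trans hz.2⟩
      calc |g z| = |lam| * |∫ y in (0 : ℝ)..z, k (z - y) * g y| := by rw [hg z hz, abs_mul]
        _ ≤ |lam| * (C * |lam| ^ n * (z ^ (n + 1) / (n + 1).factorial)) := by gcongr
        _ = C * |lam| ^ (n + 1) * (z ^ (n + 1) / (n + 1).factorial) := by ring
  intro z hz
  have h_lim : Filter.Tendsto (fun n : ℕ => C * ((|lam| * z) ^ n / n.factorial)) Filter.atTop
      (nhds (C * 0)) := (FloorSemiring.tendsto_pow_div_factorial_atTop _).const_mul C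
  rw [mul_zero] at h_lim
  refine abs_nonpos_iff.1 (ge_of_tendsto' h_lim fun n => (h_iterate n z hz).trans_eq ?_)
  rw [mul_pow]
  ring

end Volterra

section RenewalSeries

variable {lam : ℝ} {G : Measure ℝ}

lemma tail_nonneg (x : ℝ) : 0 ≤ tail G x := measureReal_nonneg

@[fun_prop]
lemma measurable_tail : Measurable (tail G) :=
  measurable_measure_Ioi.ennreal_toReal

@[fun_prop]
lemma measurable_tailConv (i : ℕ) : Measurable (tailConv G i) := by
  induction i with
  | zero => exact measurable_tail
  | succ i ih =>
    exact measurable_intervalIntegral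
      (F := fun p => tail G (p.1 - p.2) * tailConv G i p.2) (by fun_prop) measurable_const
      measurable_id

lemma tailConv_nonneg (i : ℕ) {x : ℝ} (hx : 0 ≤ x) : 0 ≤ tailConv G i x := by
  induction i generalizing x with
  | zero => exact tail_nonneg x
  | succ i ih =>
    exact intervalIntegral.integral_nonneg hx fun y hy => mul_nonneg (tail_nonneg _) (ih hy.1)

/-- The sum of the convolution powers of `lam * tail G`. -/
noncomputable def renewal (lam : ℝ) (G : Measure ℝ) (x : ℝ) : ℝ :=
  ∑' i : ℕ, lam ^ (i + 1) * tailConv G i x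

@[fun_prop]
lemma measurable_renewal : Measurable (renewal lam G) :=
  Measurable.tsum fun i => (measurable_tailConv i).const_mul _

lemma renewal_nonneg (hlam : 0 ≤ lam) {x : ℝ} (hx : 0 ≤ x) : 0 ≤ renewal lam G x :=
  tsum_nonneg fun i => mul_nonneg (pow_nonneg hlam _) (tailConv_nonneg i hx)

variable [IsProbabilityMeasure G]

lemma abs_tail_le_one (x : ℝ) : |tail G x| ≤ 1 :=
  (abs_of_nonneg (tail_nonneg x)).trans_le measureReal_le_one

lemma ofReal_tail (x : ℝ) : ENNReal.ofReal (tail G x) = G (Ioi x) := ofReal_measureReal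

lemma abs_tailConv_le (i : ℕ) {x : ℝ} (hx : 0 ≤ x) :
    |tailConv G i x| ≤ x ^ i / i.factorial := by
  induction i generalizing x with
  | zero => simpa [tailConv] using abs_tail_le_one x
  | succ i ih =>
    simpa [tailConv] using abs_integral_mul_le_pow_succ_div_factorial abs_tail_le_one hx (C := 1)
      fun y hy => (ih hy.1.le).trans_eq (one_mul _).symm

lemma hasSum_pow_succ_mul_pow_div_factorial (a b : ℝ) :
    HasSum (fun i : ℕ => a ^ (i + 1) * (b ^ i / i.factorial)) (a * Real.exp (a * b)) := by
  rw [Real.exp_eq_exp_ℝ]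
  refine ((NormedSpace.expSeries_div_hasSum_exp (a * b)).mul_left a).congr_fun fun i => ?_
  rw [mul_pow, pow_succ]
  ring

lemma abs_pow_succ_mul_tailConv_le (i : ℕ) {x b : ℝ} (hx : x ∈ Icc 0 b) :
    |lam ^ (i + 1) * tailConv G i x| ≤ |lam| ^ (i + 1) * (b ^ i / i.factorial) := by
  rw [abs_mul, abs_pow]
  gcongr
  refine (abs_tailConv_le i hx.1).trans ?_
  gcongr
  exacts [hx.1, hx.2]

lemma summable_renewal {x : ℝ} (hx : 0 ≤ x) :
    Summable fun i : ℕ => lam ^ (i + 1) * tailConv G i x :=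
  .of_norm_bounded (hasSum_pow_succ_mul_pow_div_factorial |lam| x).summable
    fun i => abs_pow_succ_mul_tailConv_le i ⟨hx, le_rfl⟩

lemma abs_renewal_le {x b : ℝ} (hx : x ∈ Icc 0 b) :
    |renewal lam G x| ≤ |lam| * Real.exp (|lam| * b) := by
  rw [renewal]
  exact tsum_of_norm_bounded (f := fun i => lam ^ (i + 1) * tailConv G i x)
    (hasSum_pow_succ_mul_pow_div_factorial |lam| b)
    fun i => abs_pow_succ_mul_tailConv_le i hx

lemma hasSum_integral_mul_tailConv {k : ℝ → ℝ} (hk : Measurable k) (hk_le : ∀ y, |k y| ≤ 1)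
    {b : ℝ} (hb : 0 ≤ b) :
    HasSum (fun i : ℕ => lam ^ (i + 1) * ∫ y in (0 : ℝ)..b, k y * tailConv G i y)
      (∫ y in (0 : ℝ)..b, k y * renewal lam G y) := by
  have h_sum : HasSum
      (fun i : ℕ => ∫ y in (0 : ℝ)..b, k y * (lam ^ (i + 1) * tailConv G i y))
      (∫ y in (0 : ℝ)..b, k y * renewal lam G y) := by
    refine intervalIntegral.hasSum_integral_of_dominated_convergence
      (fun i _ => |lam| ^ (i + 1) * (b ^ i / i.factorial)) (fun i => ?_)
      (fun i => .of_forall fun y hy => ?_)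
      (.of_forall fun y _ => (hasSum_pow_succ_mul_pow_div_factorial |lam| b).summable)
      intervalIntegrable_const (.of_forall fun y hy => ?_)
    · exact Measurable.aestronglyMeasurable (by fun_prop)
    · rw [uIoc_of_le hb] at hy
      rw [norm_mul]
      exact (mul_le_of_le_one_left (norm_nonneg _) (hk_le y)).trans
        (abs_pow_succ_mul_tailConv_le i (Ioc_subset_Icc_self hy))
    · rw [uIoc_of_le hb] at hy
      exact (summable_renewal hy.1.le).hasSum.mul_left (k y)
  simpa only [mul_left_comm (k _), intervalIntegral.integral_const_mul] using h_sum

lemma hasSum_integral_tail_mul_tailConv (z : ℝ) {b : ℝ} (hb : 0 ≤ b) :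
    HasSum (fun i : ℕ => lam ^ (i + 1) * ∫ y in (0 : ℝ)..b, tail G (z - y) * tailConv G i y)
      (∫ y in (0 : ℝ)..b, tail G (z - y) * renewal lam G y) :=
  hasSum_integral_mul_tailConv (by fun_prop) (fun _ => abs_tail_le_one _) hb

lemma hasSum_integral_tailConv {b : ℝ} (hb : 0 ≤ b) :
    HasSum (fun i : ℕ => lam ^ (i + 1) * ∫ y in (0 : ℝ)..b, tailConv G i y)
      (∫ y in (0 : ℝ)..b, renewal lam G y) := by
  simpa using hasSum_integral_mul_tailConv (G := G) (lam := lam) (k := 1) measurable_one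
    (by simp) hb

lemma renewal_eq {z : ℝ} (hz : 0 ≤ z) : renewal lam G z =
    lam * (tail G z + ∫ y in (0 : ℝ)..z, tail G (z - y) * renewal lam G y) := by
  rw [renewal, (summable_renewal hz).tsum_eq_zero_add,
    ← (hasSum_integral_tail_mul_tailConv z hz).tsum_eq, mul_add, ← tsum_mul_left]
  congr 1
  · rw [zero_add, pow_one, tailConv]
  · refine tsum_congr fun i => ?_
    rw [pow_succ' lam (i + 1), mul_assoc, tailConv]

lemma intervalIntegrable_of_abs_le {g : ℝ → ℝ} (hg : Measurable g) {a b C : ℝ}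
    (hC : ∀ y ∈ uIoc a b, |g y| ≤ C) : IntervalIntegrable g volume a b :=
  (intervalIntegrable_const (c := C)).mono_fun hg.aestronglyMeasurable <|
    ae_restrict_of_forall_mem measurableSet_uIoc fun y hy =>
      (hC y hy).trans (le_abs_self C)

lemma intervalIntegrable_renewal {b : ℝ} (hb : 0 ≤ b) :
    IntervalIntegrable (renewal lam G) volume 0 b :=
  intervalIntegrable_of_abs_le measurable_renewal fun _ hy =>
    abs_renewal_le (Ioc_subset_Icc_self (uIoc_of_le hb ▸ hy))

lemma intervalIntegrable_tail_mul {g : ℝ → ℝ} {a b : ℝ} (hg : IntervalIntegrable g volume a b)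
    (z : ℝ) : IntervalIntegrable (fun y => tail G (z - y) * g y) volume a b := by
  rw [intervalIntegrable_iff] at hg ⊢
  exact hg.bdd_mul (Measurable.aestronglyMeasurable (by fun_prop))
    (.of_forall fun _ => abs_tail_le_one _)

lemma eq_mul_renewal_of_volterra {f : ℝ → ℝ} {b α C : ℝ} (hf : Measurable f)
    (hC : ∀ y ∈ Ioc 0 b, |f y| ≤ C)
    (h_eq : ∀ z ∈ Ioc 0 b,
      f z = lam * (α * tail G z + ∫ y in (0 : ℝ)..z, tail G (z - y) * f y)) :
    ∀ z ∈ Ioc 0 b, f z = α * renewal lam G z := by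
  let d : ℝ → ℝ := fun z => f z - α * renewal lam G z
  have h_bound : ∀ y ∈ Ioc 0 b, |d y| ≤ C + |α| * (|lam| * Real.exp (|lam| * b)) := by
    intro y hy
    refine (abs_sub _ _).trans (add_le_add (hC y hy) ?_)
    rw [abs_mul]
    exact mul_le_mul_of_nonneg_left (abs_renewal_le (Ioc_subset_Icc_self hy)) (abs_nonneg α)
  have h_volterra : ∀ z ∈ Ioc 0 b, d z = lam * ∫ y in (0 : ℝ)..z, tail G (z - y) * d y := by
    intro z hz
    have hf_int : IntervalIntegrable f volume 0 z := intervalIntegrable_of_abs_le hf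
      fun y hy => hC y (Ioc_subset_Ioc_right hz.2 (uIoc_of_le hz.1.le ▸ hy))
    have h_int : ∫ y in (0 : ℝ)..z, tail G (z - y) * d y =
        (∫ y in (0 : ℝ)..z, tail G (z - y) * f y) -
          α * ∫ y in (0 : ℝ)..z, tail G (z - y) * renewal lam G y := by
      simp only [d, mul_sub, mul_left_comm _ α]
      rw [intervalIntegral.integral_sub (intervalIntegrable_tail_mul hf_int z)
        ((intervalIntegrable_tail_mul (intervalIntegrable_renewal hz.1.le) z).const_mul α),
        intervalIntegral.integral_const_mul]
    rw [h_int]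
    simp only [d]
    rw [h_eq z hz, renewal_eq hz.1.le]
    ring
  exact fun z hz => sub_eq_zero.1 (eq_zero_of_volterra abs_tail_le_one h_bound h_volterra z hz)

lemma normalizer_eq : normalizer lam G =
    1 + lam * (∫ s, s ∂G) * (1 + ∫ y in (0 : ℝ)..1, renewal lam G y) := by
  rw [normalizer, (hasSum_integral_tailConv zero_le_one).tsum_eq]

end RenewalSeries

section AtomDensity

/-- The measure with an atom of mass `a` at `0` and density `c` on `(0, ∞)`. -/
noncomputable def atomDensity (a : ℝ≥0∞) (c : ℝ → ℝ≥0∞) : Measure ℝ :=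
  a • Measure.dirac 0 + (volume.restrict (Ioi 0)).withDensity c

variable {G π : Measure ℝ} {a : ℝ≥0∞} {c c' f : ℝ → ℝ≥0∞} {s : Set ℝ}

lemma atomDensity_congr (h : ∀ x ∈ Ioi 0, c x = c' x) : atomDensity a c = atomDensity a c' := by
  rw [atomDensity, withDensity_congr_ae (ae_restrict_of_forall_mem measurableSet_Ioi h),
    atomDensity]

lemma atomDensity_mul (hc : Measurable c) :
    atomDensity a (fun x => a * c x) = a • atomDensity 1 c := by
  have h_smul : (fun x => a * c x) = a • c := rfl
  rw [atomDensity, atomDensity, h_smul, withDensity_smul a hc, one_smul, smul_add]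

lemma eq_atomDensity (hπ : π (Iio 0) = 0)
    (hc : π.restrict (Ioi 0) = (volume.restrict (Ioi 0)).withDensity c) :
    π = atomDensity (π {0}) c := by
  have h_ae : (Iic 0 : Set ℝ) =ᵐ[π] ({0} : Set ℝ) := by
    rw [← Iio_union_right]
    exact union_ae_eq_right_of_ae_eq_empty (ae_eq_empty.2 hπ)
  rw [atomDensity, ← hc, ← Measure.restrict_singleton, ← Measure.restrict_congr_set h_ae,
    ← compl_Iic, Measure.restrict_add_restrict_compl measurableSet_Iic]

lemma restrict_Ioi_atomDensity :
    (atomDensity a c).restrict (Ioi 0) = (volume.restrict (Ioi 0)).withDensity c := by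
  rw [atomDensity, Measure.restrict_add, Measure.restrict_smul, restrict_dirac' measurableSet_Ioi,
    if_neg self_notMem_Ioi, smul_zero, zero_add, restrict_withDensity measurableSet_Ioi,
    Measure.restrict_restrict measurableSet_Ioi, inter_self]

lemma setLIntegral_atomDensity (hc : Measurable c) (hf : Measurable f) (hs : MeasurableSet s)
    (h_zero : 0 ∈ s) :
    ∫⁻ x in s, f x ∂atomDensity a c = a * f 0 + ∫⁻ x in s ∩ Ioi 0, f x * c x := by
  classical
  rw [atomDensity, Measure.restrict_add, Measure.restrict_smul, restrict_dirac' hs,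
    if_pos h_zero, restrict_withDensity hs, Measure.restrict_restrict hs, lintegral_add_measure,
    lintegral_smul_measure, lintegral_dirac, smul_eq_mul,
    lintegral_withDensity_eq_lintegral_mul _ hc hf]
  simp only [Pi.mul_apply, mul_comm]

lemma atomDensity_univ : atomDensity a c univ = a + atomDensity a c (Ioi 0) := by
  simp [atomDensity]

lemma atomDensity_Iio_zero : atomDensity a c (Iio 0) = 0 := by
  simp [atomDensity, inter_comm (Iio (0 : ℝ)), Ioi_inter_Iio]

lemma atomDensity_Iio_one (hc : Measurable c) :
    atomDensity a c (Iio 1) = a + ∫⁻ x in Ioc 0 1, c x := by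
  have := setLIntegral_atomDensity (a := a) hc measurable_one measurableSet_Iio
    (mem_Iio.2 (zero_lt_one (α := ℝ)))
  simpa [inter_comm (Iio (1 : ℝ)), Ioi_inter_Iio, setLIntegral_congr Ioo_ae_eq_Ioc] using this

lemma measurable_measure_Ioi_const_sub (z : ℝ) : Measurable fun x => G (Ioi (z - x)) :=
  measurable_measure_Ioi.comp (measurable_const.sub measurable_id)

lemma upcrossing_atomDensity (hc : Measurable c) {z : ℝ} (hz : 0 ≤ z) :
    upcrossing G (atomDensity a c) z =
      a * G (Ioi z) + ∫⁻ x in Ioc 0 (min z 1), G (Ioi (z - x)) * c x := by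
  have h_ae : (Iic z ∩ Iio 1 ∩ Ioi 0 : Set ℝ) =ᵐ[volume] Ioc 0 (min z 1) := by
    rw [← Ioi_inter_Iic, ← Iic_inter_Iic, inter_comm (Ioi 0)]
    exact ((ae_eq_refl _).inter Iio_ae_eq_Iic).inter (ae_eq_refl _)
  rw [upcrossing, setLIntegral_indicator measurableSet_Iic,
    setLIntegral_atomDensity hc (measurable_measure_Ioi_const_sub z)
      (measurableSet_Iic.inter measurableSet_Iio) ⟨hz, mem_Iio.2 one_pos⟩,
    sub_zero, setLIntegral_congr h_ae]

end AtomDensity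

section Solution

variable {lam : ℝ} {G π : Measure ℝ}

lemma upcrossing_of_neg (hπ : π (Iio 0) = 0) {z : ℝ} (hz : z < 0) : upcrossing G π z = 0 := by
  refine lintegral_eq_zero_of_ae_eq_zero (ae_restrict_of_ae ?_)
  exact (ae_nonneg_of_measure_Iio_zero hπ).mono fun x hx =>
    indicator_of_notMem (s := Iic z) (fun hxz => (hz.trans_le hx).not_ge hxz) _

lemma lintegral_upcrossing [SFinite G] [SFinite π] :
    ∫⁻ z, upcrossing G π z = (∫⁻ s, ENNReal.ofReal s ∂G) * π (Iio 1) := by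
  have h_inner (x : ℝ) : ∫⁻ z in Ici x, G (Ioi (z - x)) = ∫⁻ s, ENNReal.ofReal s ∂G := by
    simpa using (lintegral_setLIntegral_Ico_add (G := G) measurable_one x).symm
  simpa [h_inner] using lintegral_mul_upcrossing (G := G) (π := π) measurable_one

lemma LevelCrossing.measure_Ioi_zero [SFinite G] [SFinite π] (h : LevelCrossing lam G π)
    (hπ : π (Iio 0) = 0) :
    π (Ioi 0) = ENNReal.ofReal lam * ((∫⁻ s, ENNReal.ofReal s ∂G) * π (Iio 1)) := by
  have h_Ici : ∫⁻ z in Ici 0, upcrossing G π z = ∫⁻ z, upcrossing G π z := by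
    rw [← lintegral_indicator measurableSet_Ici]
    refine congrArg _ (indicator_eq_self.2 fun z hz => by_contra fun hz' => hz ?_)
    exact upcrossing_of_neg hπ (not_le.1 hz')
  rw [← Measure.restrict_apply_self, h, withDensity_apply _ measurableSet_Ioi,
    Measure.restrict_restrict measurableSet_Ioi, inter_self,
    lintegral_const_mul _ measurable_upcrossing, setLIntegral_congr Ioi_ae_eq_Ici, h_Ici,
    lintegral_upcrossing]

/-- The invariant density on `(0, ∞)` before normalization; the upper limit `min z 1` covers both
cases of `invariantDensity`. -/
noncomputable def unnormalizedDensity (lam : ℝ) (G : Measure ℝ) (z : ℝ) : ℝ :=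
  lam * (tail G z + ∫ y in (0 : ℝ)..min z 1, tail G (z - y) * renewal lam G y)

@[fun_prop]
lemma measurable_unnormalizedDensity : Measurable (unnormalizedDensity lam G) :=
  (measurable_tail.add (measurable_intervalIntegral
    (F := fun p => tail G (p.1 - p.2) * renewal lam G p.2) (by fun_prop) measurable_const
    (by fun_prop))).const_mul lam

lemma setLIntegral_Ioc_ofReal {f : ℝ → ℝ} {b : ℝ} (hb : 0 ≤ b)
    (hf : IntervalIntegrable f volume 0 b) (hf_nonneg : ∀ x ∈ Ioc 0 b, 0 ≤ f x) :
    ∫⁻ x in Ioc 0 b, ENNReal.ofReal (f x) = ENNReal.ofReal (∫ x in (0 : ℝ)..b, f x) := by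
  rw [intervalIntegral.integral_of_le hb, ofReal_integral_eq_lintegral_ofReal
    ((intervalIntegrable_iff_integrableOn_Ioc_of_le hb).1 hf)
    (ae_restrict_of_forall_mem measurableSet_Ioc hf_nonneg)]

lemma integral_id_nonneg (hG : G (Iio 0) = 0) : 0 ≤ ∫ s, s ∂G :=
  integral_nonneg_of_ae (ae_nonneg_of_measure_Iio_zero hG)

lemma integral_renewal_nonneg (hlam : 0 ≤ lam) : 0 ≤ ∫ y in (0 : ℝ)..1, renewal lam G y :=
  intervalIntegral.integral_nonneg zero_le_one fun _ hy => renewal_nonneg hlam hy.1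

/-- The invariant measure with mass `1` at `0`. -/
noncomputable def unnormalizedLaw (lam : ℝ) (G : Measure ℝ) : Measure ℝ :=
  atomDensity 1 fun x => ENNReal.ofReal (unnormalizedDensity lam G x)

instance : SFinite (unnormalizedLaw lam G) := by
  unfold unnormalizedLaw atomDensity
  infer_instance

/-- The invariant distribution of the workload process. -/
noncomputable def stationaryLaw (lam : ℝ) (G : Measure ℝ) : Measure ℝ :=
  (ENNReal.ofReal (normalizer lam G))⁻¹ • unnormalizedLaw lam G

lemma stationaryLaw_Iio_zero : stationaryLaw lam G (Iio 0) = 0 := by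
  rw [stationaryLaw, Measure.smul_apply, unnormalizedLaw, atomDensity_Iio_zero, smul_zero]

variable [IsProbabilityMeasure G]

lemma unnormalizedDensity_eq_renewal {z : ℝ} (hz : z ∈ Icc 0 1) :
    unnormalizedDensity lam G z = renewal lam G z := by
  rw [unnormalizedDensity, min_eq_left hz.2, renewal_eq hz.1]

lemma invariantDensity_eq_div {x : ℝ} (hx : 0 < x) :
    invariantDensity lam G x = unnormalizedDensity lam G x / normalizer lam G := by
  rw [invariantDensity]
  split_ifs with h
  · rw [unnormalizedDensity_eq_renewal ⟨hx.le, h⟩, renewal]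
  · rw [unnormalizedDensity, min_eq_right (not_le.1 h).le, mul_add,
      (hasSum_integral_tail_mul_tailConv x zero_le_one).tsum_eq]

lemma setLIntegral_measure_Ioi_mul_ofReal {f : ℝ → ℝ} {b : ℝ} (hb : 0 ≤ b)
    (hf : IntervalIntegrable f volume 0 b) (hf_nonneg : ∀ x ∈ Ioc 0 b, 0 ≤ f x) (z : ℝ) :
    ∫⁻ x in Ioc 0 b, G (Ioi (z - x)) * ENNReal.ofReal (f x) =
      ENNReal.ofReal (∫ x in (0 : ℝ)..b, tail G (z - x) * f x) := by
  rw [← setLIntegral_Ioc_ofReal hb (intervalIntegrable_tail_mul hf z) fun x hx =>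
    mul_nonneg (tail_nonneg _) (hf_nonneg x hx)]
  simp only [ENNReal.ofReal_mul (tail_nonneg _), ofReal_tail]

lemma ofReal_mul_upcrossing_atomDensity (hlam : 0 ≤ lam) {a : ℝ≥0∞} {c : ℝ → ℝ≥0∞}
    (hc : Measurable c) (h_eq : ∀ x ∈ Ioc 0 1, c x = a * ENNReal.ofReal (renewal lam G x))
    {z : ℝ} (hz : 0 ≤ z) :
    ENNReal.ofReal lam * upcrossing G (atomDensity a c) z =
      a * ENNReal.ofReal (unnormalizedDensity lam G z) := by
  have hb : 0 ≤ min z 1 := le_min hz zero_le_one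
  have h_renewal : ∀ x ∈ Ioc 0 (min z 1), 0 ≤ renewal lam G x :=
    fun x hx => renewal_nonneg hlam hx.1.le
  have h_int : ∫⁻ x in Ioc 0 (min z 1), G (Ioi (z - x)) * c x =
      a * ENNReal.ofReal (∫ x in (0 : ℝ)..min z 1, tail G (z - x) * renewal lam G x) := by
    have h_meas : Measurable fun x => G (Ioi (z - x)) * ENNReal.ofReal (renewal lam G x) :=
      (measurable_measure_Ioi_const_sub z).mul measurable_renewal.ennreal_ofReal
    rw [← setLIntegral_measure_Ioi_mul_ofReal hb (intervalIntegrable_renewal hb) h_renewal,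
      ← lintegral_const_mul _ h_meas]
    refine setLIntegral_congr_fun measurableSet_Ioc fun x hx => ?_
    simp only [h_eq x ⟨hx.1, hx.2.trans (min_le_right _ _)⟩, mul_left_comm]
  have h_nonneg : 0 ≤ ∫ x in (0 : ℝ)..min z 1, tail G (z - x) * renewal lam G x :=
    intervalIntegral.integral_nonneg hb fun x hx =>
      mul_nonneg (tail_nonneg _) (renewal_nonneg hlam hx.1)
  rw [upcrossing_atomDensity hc hz, h_int, ← ofReal_tail, ← mul_add,
    ← ENNReal.ofReal_add (tail_nonneg z) h_nonneg, unnormalizedDensity, ENNReal.ofReal_mul hlam,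
    mul_left_comm]

lemma levelCrossing_unnormalizedLaw (hlam : 0 ≤ lam) :
    LevelCrossing lam G (unnormalizedLaw lam G) := by
  rw [LevelCrossing, unnormalizedLaw, restrict_Ioi_atomDensity]
  refine withDensity_congr_ae (ae_restrict_of_forall_mem measurableSet_Ioi fun z hz => ?_)
  refine ((ofReal_mul_upcrossing_atomDensity hlam (by fun_prop) (fun x hx => ?_)
    (mem_Ioi.1 hz).le).trans (one_mul _)).symm
  rw [unnormalizedDensity_eq_renewal (Ioc_subset_Icc_self hx), one_mul]

lemma normalizer_pos (hlam : 0 ≤ lam) (hG : G (Iio 0) = 0) : 0 < normalizer lam G := by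
  have h_mean := integral_id_nonneg hG
  have h_renewal := integral_renewal_nonneg (G := G) hlam
  rw [normalizer_eq]
  positivity

lemma unnormalizedLaw_univ (hlam : 0 ≤ lam) (hG : G (Iio 0) = 0)
    (hmean : Integrable (fun s => s) G) :
    unnormalizedLaw lam G univ = ENNReal.ofReal (normalizer lam G) := by
  have h_mean := integral_id_nonneg hG
  have h_renewal := integral_renewal_nonneg (G := G) hlam
  have h_Iio : unnormalizedLaw lam G (Iio 1) =
      ENNReal.ofReal (1 + ∫ y in (0 : ℝ)..1, renewal lam G y) := by
    rw [unnormalizedLaw, atomDensity_Iio_one (by fun_prop),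
      setLIntegral_congr_fun measurableSet_Ioc fun x hx => congrArg ENNReal.ofReal
        (unnormalizedDensity_eq_renewal (Ioc_subset_Icc_self hx)),
      setLIntegral_Ioc_ofReal zero_le_one (intervalIntegrable_renewal zero_le_one)
        fun x hx => renewal_nonneg hlam hx.1.le,
      ENNReal.ofReal_add zero_le_one h_renewal, ENNReal.ofReal_one]
  have h_Ioi := (levelCrossing_unnormalizedLaw (G := G) hlam).measure_Ioi_zero atomDensity_Iio_zero
  rw [h_Iio, ← ofReal_integral_eq_lintegral_ofReal hmean
    (ae_nonneg_of_measure_Iio_zero hG),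
    ← ENNReal.ofReal_mul h_mean, ← ENNReal.ofReal_mul hlam] at h_Ioi
  rw [unnormalizedLaw, atomDensity_univ, ← unnormalizedLaw, h_Ioi, ← ENNReal.ofReal_one,
    ← ENNReal.ofReal_add zero_le_one (by positivity), normalizer_eq, mul_assoc]

lemma LevelCrossing.ofReal_mul_upcrossing_eq [IsProbabilityMeasure π] (h : LevelCrossing lam G π)
    (hlam : 0 ≤ lam) (hπ : π (Iio 0) = 0) : ∀ z ∈ Ioc 0 1,
      ENNReal.ofReal lam * upcrossing G π z = π {0} * ENNReal.ofReal (renewal lam G z) := by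
  let f : ℝ → ℝ := fun z => lam * (upcrossing G π z).toReal
  have hf_meas : Measurable f := measurable_upcrossing.ennreal_toReal.const_mul lam
  have hf_nonneg (z : ℝ) : 0 ≤ f z := mul_nonneg hlam ENNReal.toReal_nonneg
  have h_up_top (z : ℝ) : upcrossing G π z ≠ ∞ := ((upcrossing_le_one z).trans_lt (by simp)).ne
  have hf_ofReal (z : ℝ) : ENNReal.ofReal lam * upcrossing G π z = ENNReal.ofReal (f z) := by
    rw [ENNReal.ofReal_mul hlam, ENNReal.ofReal_toReal (h_up_top z)]
  have hf_le (z : ℝ) : |f z| ≤ lam := by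
    rw [abs_of_nonneg (hf_nonneg z)]
    exact mul_le_of_le_one_right hlam (ENNReal.toReal_mono (by simp) (upcrossing_le_one z))
  have h_volterra : ∀ z ∈ Ioc 0 1, f z =
      lam * (π.real {0} * tail G z + ∫ y in (0 : ℝ)..z, tail G (z - y) * f y) := by
    intro z hz
    have h_up : upcrossing G π z =
        π {0} * G (Ioi z) + ENNReal.ofReal (∫ y in (0 : ℝ)..z, tail G (z - y) * f y) := by
      conv_lhs => rw [eq_atomDensity hπ h, upcrossing_atomDensity (by fun_prop) hz.1.le]
      simp only [min_eq_left hz.2, hf_ofReal]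
      rw [setLIntegral_measure_Ioi_mul_ofReal hz.1.le
        (intervalIntegrable_of_abs_le hf_meas fun y _ => hf_le y) fun y _ => hf_nonneg y]
    have h_int_nonneg : 0 ≤ ∫ y in (0 : ℝ)..z, tail G (z - y) * f y :=
      intervalIntegral.integral_nonneg hz.1.le fun y _ =>
        mul_nonneg (tail_nonneg _) (hf_nonneg y)
    change lam * (upcrossing G π z).toReal = _
    rw [h_up, ENNReal.toReal_add (by finiteness) ENNReal.ofReal_ne_top, ENNReal.toReal_mul,
      ENNReal.toReal_ofReal h_int_nonneg, Measure.real, tail, Measure.real]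
  intro z hz
  rw [hf_ofReal, eq_mul_renewal_of_volterra hf_meas (fun y _ => hf_le y) h_volterra z hz,
    ENNReal.ofReal_mul measureReal_nonneg, ofReal_measureReal]

lemma LevelCrossing.eq_smul_unnormalizedLaw [IsProbabilityMeasure π] (h : LevelCrossing lam G π)
    (hlam : 0 ≤ lam) (hπ : π (Iio 0) = 0) : π = π {0} • unnormalizedLaw lam G := by
  have h_atom : π = atomDensity (π {0}) fun z => ENNReal.ofReal lam * upcrossing G π z :=
    eq_atomDensity hπ h
  have h_density : ∀ z ∈ Ioi 0, ENNReal.ofReal lam * upcrossing G π z =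
      π {0} * ENNReal.ofReal (unnormalizedDensity lam G z) := by
    intro z hz
    conv_lhs => rw [h_atom]
    exact ofReal_mul_upcrossing_atomDensity hlam (by fun_prop)
      (h.ofReal_mul_upcrossing_eq hlam hπ) (mem_Ioi.1 hz).le
  rw [unnormalizedLaw, ← atomDensity_mul (by fun_prop), ← atomDensity_congr h_density]
  exact h_atom

lemma isProbabilityMeasure_stationaryLaw (hlam : 0 ≤ lam) (hG : G (Iio 0) = 0)
    (hmean : Integrable (fun s => s) G) : IsProbabilityMeasure (stationaryLaw lam G) := by
  constructor
  rw [stationaryLaw, Measure.smul_apply, unnormalizedLaw_univ hlam hG hmean, smul_eq_mul]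
  exact ENNReal.inv_mul_cancel (ENNReal.ofReal_pos.2 (normalizer_pos hlam hG)).ne'
    ENNReal.ofReal_ne_top

lemma restrict_Ioi_stationaryLaw (hlam : 0 ≤ lam) (hG : G (Iio 0) = 0) :
    (stationaryLaw lam G).restrict (Ioi 0) = (volume.restrict (Ioi 0)).withDensity
      fun x => ENNReal.ofReal (invariantDensity lam G x) := by
  rw [stationaryLaw, Measure.restrict_smul, unnormalizedLaw, restrict_Ioi_atomDensity,
    ← withDensity_smul _ (by fun_prop)]
  refine withDensity_congr_ae (ae_restrict_of_forall_mem measurableSet_Ioi fun x hx => ?_)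
  simp only [Pi.smul_apply, smul_eq_mul]
  rw [invariantDensity_eq_div hx, ENNReal.ofReal_div_of_pos (normalizer_pos hlam hG),
    ENNReal.div_eq_inv_mul]

lemma levelCrossing_iff_eq_stationaryLaw [IsProbabilityMeasure π] (hlam : 0 ≤ lam)
    (hG : G (Iio 0) = 0) (hmean : Integrable (fun s => s) G) (hπ : π (Iio 0) = 0) :
    LevelCrossing lam G π ↔ π = stationaryLaw lam G := by
  constructor
  · intro h
    have h_smul := h.eq_smul_unnormalizedLaw hlam hπ
    have h_univ : 1 = π {0} * ENNReal.ofReal (normalizer lam G) := by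
      rw [← unnormalizedLaw_univ hlam hG hmean, ← smul_eq_mul, ← Measure.smul_apply, ← h_smul,
        measure_univ]
    rwa [ENNReal.eq_inv_of_mul_eq_one_left h_univ.symm, ← stationaryLaw] at h_smul
  · rintro rfl
    exact (levelCrossing_unnormalizedLaw hlam).smul _

lemma IsMG1Input.isInvariant_iff_eq_stationaryLaw {Ω : Type*} [MeasurableSpace Ω] {P : Measure Ω}
    [IsProbabilityMeasure P] {I S : ℕ → Ω → ℝ} (h : IsMG1Input P lam G I S) (hlam : 0 < lam)
    (hG : G (Iio 0) = 0) (hmean : Integrable (fun s => s) G) :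
    IsInvariant P I S π ↔ π = stationaryLaw lam G := by
  have h_prob := isProbabilityMeasure_stationaryLaw hlam.le hG hmean
  have h_iff (ρ : Measure ℝ) [IsProbabilityMeasure ρ] (hρ : ρ (Iio 0) = 0) :
      IsInvariant P I S ρ ↔ ρ = stationaryLaw lam G := by
    rw [h.isInvariant_iff_eq_stepLaw hlam, eq_stepLaw_iff_levelCrossing hlam hG hρ,
      levelCrossing_iff_eq_stationaryLaw hlam.le hG hmean hρ]
  constructor
  · intro h_inv
    have := h_inv.isProbabilityMeasure
    exact (h_iff π h_inv.nonneg).1 h_inv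
  · rintro rfl
    exact (h_iff _ stationaryLaw_Iio_zero).2 rfl

end Solution

end BoundedWait

open BoundedWait in
theorem theorem4 {Ω : Type*} [MeasurableSpace Ω] (P : Measure Ω) [IsProbabilityMeasure P]
    (lam : ℝ) (hlam : 0 < lam)
    (G : Measure ℝ) [IsProbabilityMeasure G] (hG : G (Iio 0) = 0)
    (I S : ℕ → Ω → ℝ) (hIS : IsMG1Input P lam G I S)
    (hmean : Integrable (fun s : ℝ => s) G) :
    (∃ π : Measure ℝ, IsInvariant P I S π) ∧
    (∀ π : Measure ℝ, IsInvariant P I S π →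
      π.restrict (Ioi 0) =
        (volume.restrict (Ioi 0)).withDensity
          (fun x => ENNReal.ofReal (invariantDensity lam G x))) ∧
    -- all series that enter the formula for the density converge
    (∀ x ∈ Ioc (0 : ℝ) 1, Summable fun i : ℕ => lam ^ (i + 1) * tailConv G i x) ∧
    (Summable fun i : ℕ => lam ^ (i + 1) * ∫ y in (0 : ℝ)..1, tailConv G i y) ∧
    (∀ x ∈ Ioi (1 : ℝ), Summable fun i : ℕ =>
      lam ^ (i + 1) * ∫ y in (0 : ℝ)..1, tail G (x - y) * tailConv G i y) := by
  have h_iff (π : Measure ℝ) := hIS.isInvariant_iff_eq_stationaryLaw (π := π) hlam hG hmean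
  refine ⟨⟨_, (h_iff _).2 rfl⟩, fun π hπ => ?_, fun x hx => summable_renewal hx.1.le,
    (hasSum_integral_tailConv zero_le_one).summable,
    fun x _ => (hasSum_integral_tail_mul_tailConv x zero_le_one).summable⟩
  rw [(h_iff π).1 hπ, restrict_Ioi_stationaryLaw hlam.le hG]
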